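/- Identify a partition $\lambda=(\lambda_1\ge\dots\ge\lambda_\ell\ge 1)$ (possibly empty) of weight $|\lambda|=\lambda_1+\dots+\lambda_\ell$ with its Ferrers diagram $\{(i,j): 1\le i\le \ell,\ 1\le j\le\lambda_i\}$. The hook length of a box $(i,j)$ of $\lambda$ is the number of boxes $(i,j')$ of $\lambda$ with $j'\ge j$ or $(i',j)$ with $i'\ge i$, the box $(i,j)$ itself being counted once. For an integer $t\ge1$, $\lambda$ is a $t$-core if none of its hook lengths is a multiple of $t$. Let $SC_{(t)}$ be the set of $t$-cores that are equal to their conjugate. For a partition $\mu^0=(\mu^0_1>\dots>\mu^0_\ell\ge 1)$ with distinct parts, its doubled distinct partition is the partition whose Ferrers diagram is obtained by shifting the $i$-th row of the diagram of $\mu^0$ by $i$ boxes to the right and then adding $\mu^0_i$ boxes to the $i$-th column, for all $1\le i\le\ell$; let $DD_{(t)}$ be the set of $t$-cores among the doubled distinct partitions. Define the formal power series $$h_t(q):=\sum_{(\lambda,\mu)\in SC_{(t)}\times DD_{(t)}} q^{|\lambda|+|\mu|},\qquad (x;x)_\infty:=\prod_{j\ge1}(1-x^j).$$ **Proposition.**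 For every integer $t\ge 0$, the sum defining $h_{t+1}(q)$ converges as a formal power series, and $$h_{t+1}(q)=\frac{(q^2;q^2)_\infty}{(q;q)_\infty}\,(q^{t+1};q^{t+1})_\infty\,(q^{2t+2};q^{2t+2})_\infty^{\,t-1},$$ where for $t=0$ the last factor is $(q^{2};q^{2})_\infty^{-1}$. -/

import Mathlib

open PowerSeries
open scoped PowerSeries.WithPiTopology LaurentSeries

namespace CoreGF

/-- The hook of a box `c = (i, j)`: the boxes of `μ` in row `i` weakly beyond `c` and those in
column `j` weakly beyond `c` (so `c` belongs to its hook). -/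
def hook (μ : YoungDiagram) (c : ℕ × ℕ) : Finset (ℕ × ℕ) :=
  μ.cells.filter fun u => (u.1 = c.1 ∧ c.2 ≤ u.2) ∨ (u.2 = c.2 ∧ c.1 ≤ u.1)

def hookLength (μ : YoungDiagram) (c : ℕ × ℕ) : ℕ := (hook μ c).card

/-- `μ` is a `t`-core: no hook length of `μ` is a multiple of `t`. -/
def IsCore (t : ℕ) (μ : YoungDiagram) : Prop := ∀ c ∈ μ.cells, ¬ t ∣ hookLength μ c

/-- The partition `ν` has distinct parts. -/
def HasDistinctParts (ν : YoungDiagram) : Prop := ν.rowLens.Nodup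

/-- The boxes of the shifted diagram: row `i` (numbered from `0`) of `ν` moved right by `i + 1`. -/
def shiftedCells (ν : YoungDiagram) : Finset (ℕ × ℕ) :=
  ν.cells.image fun c => (c.1, c.1 + 1 + c.2)

/-- The boxes added to the shifted diagram: `ν_i` boxes in column `i`. In that column the shifted
diagram occupies exactly the rows before `i`, so the new boxes are in rows `i, …, i + ν_i - 1`. -/
def addedCells (ν : YoungDiagram) : Finset (ℕ × ℕ) :=
  ν.cells.image fun c => (c.1 + c.2, c.1)

theorem mem_doubled_iff (ν : YoungDiagram) (a b : ℕ) :
    (a, b) ∈ shiftedCells ν ∪ addedCells ν ↔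
      (a < b ∧ (a, b - a - 1) ∈ ν) ∨ (b ≤ a ∧ (b, a - b) ∈ ν) := by
  simp only [shiftedCells, addedCells, Finset.mem_union, Finset.mem_image, Prod.mk.injEq,
    Prod.exists, YoungDiagram.mem_cells]
  constructor
  · rintro (⟨i, j, h, rfl, rfl⟩ | ⟨i, j, h, rfl, rfl⟩)
    · left
      refine ⟨by omega, ?_⟩
      have : i + 1 + j - i - 1 = j := by omega
      rwa [this]
    · right
      refine ⟨by omega, ?_⟩
      have : i + j - i = j := by omega
      rwa [this]
  · rintro (⟨h, hm⟩ | ⟨h, hm⟩)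
    · exact Or.inl ⟨_, _, hm, rfl, by omega⟩
    · exact Or.inr ⟨_, _, hm, by omega, rfl⟩

theorem HasDistinctParts.step {ν : YoungDiagram} (h : HasDistinctParts ν) {i j : ℕ}
    (hm : (i + 1, j) ∈ ν) : (i, j + 1) ∈ ν := by
  have h0 : (i + 1, 0) ∈ ν := ν.up_left_mem le_rfl (Nat.zero_le _) hm
  have hl : i + 1 < ν.rowLens.length := by
    rw [YoungDiagram.length_rowLens]
    exact YoungDiagram.mem_iff_lt_colLen.1 h0
  have hne : ν.rowLen i ≠ ν.rowLen (i + 1) := by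
    intro he
    have := (List.Nodup.getElem_inj_iff h (hi := (by omega : i < ν.rowLens.length))
      (hj := hl)).1 (by simpa [YoungDiagram.rowLens] using he)
    omega
  have hle := ν.rowLen_anti i (i + 1) (by omega)
  rw [YoungDiagram.mem_iff_lt_rowLen] at hm ⊢
  omega

theorem HasDistinctParts.steps {ν : YoungDiagram} (h : HasDistinctParts ν) (k : ℕ) :
    ∀ {i j : ℕ}, (i + k, j) ∈ ν → (i, j + k) ∈ ν := by
  induction k with
  | zero => intro i j hm; exact hm
  | succ k ih =>
    intro i j hm
    have h1 : (i + k, j + 1) ∈ ν := h.step (by rwa [← add_assoc] at hm)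
    have h2 := ih h1
    rwa [show j + 1 + k = j + (k + 1) by omega] at h2

theorem HasDistinctParts.mem_of_le {ν : YoungDiagram} (h : HasDistinctParts ν) {i j i' j' : ℕ}
    (hm : (i, j) ∈ ν) (hi : i' ≤ i) (hj : j' ≤ j + (i - i')) : (i', j') ∈ ν := by
  have h1 : (i', j + (i - i')) ∈ ν := by
    apply h.steps
    rwa [show i' + (i - i') = i by omega]
  exact ν.up_left_mem le_rfl hj h1

/-- The doubled distinct partition of a partition `ν` with distinct parts. -/
def doubled (ν : YoungDiagram) (h : HasDistinctParts ν) : YoungDiagram where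
  cells := shiftedCells ν ∪ addedCells ν
  isLowerSet := by
    rintro ⟨a, b⟩ ⟨a', b'⟩ ⟨ha, hb⟩ hm
    simp only at ha hb
    rw [Finset.mem_coe, mem_doubled_iff] at hm ⊢
    by_cases hc : a' < b'
    · left
      refine ⟨hc, ?_⟩
      rcases hm with ⟨_, hm⟩ | ⟨_, hm⟩
      · exact h.mem_of_le hm ha (by omega)
      · exact h.mem_of_le hm (by omega) (by omega)
    · right
      refine ⟨by omega, ?_⟩
      rcases hm with ⟨_, hm⟩ | ⟨_, hm⟩
      · exact h.mem_of_le hm (by omega) (by omega)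
      · exact h.mem_of_le hm hb (by omega)

/-- The set of doubled distinct partitions. -/
def DD : Set YoungDiagram := {μ | ∃ (ν : YoungDiagram) (h : HasDistinctParts ν), μ = doubled ν h}

/-- The set of self-conjugate `t`-cores. -/
def SCcore (t : ℕ) : Set YoungDiagram := {μ | IsCore t μ ∧ μ.transpose = μ}

/-- The set of doubled distinct `t`-cores. -/
def DDcore (t : ℕ) : Set YoungDiagram := {μ | IsCore t μ ∧ μ ∈ DD}

/-- The monomial `q ^ (|μ₁| + |μ₂|)` of a pair of partitions. -/
noncomputable def weightMonomial (t : ℕ) (p : SCcore t × DDcore t) : ℚ⟦X⟧ :=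
  X ^ (p.1.1.card + p.2.1.card)

/-- The generating function `h_t(q)` of the pairs in `SCcore t × DDcore t`, as a formal power
series (sums and products converge coefficientwise). -/
noncomputable def h (t : ℕ) : ℚ⟦X⟧ := ∑' p : SCcore t × DDcore t, weightMonomial t p

/-- `(x; x)_∞ = ∏_{j ≥ 1} (1 - x ^ j)`. -/
noncomputable def qProd (x : ℚ⟦X⟧) : ℚ⟦X⟧ := ∏' j : ℕ, (1 - x ^ (j + 1))

/-- The product that defines `(q ^ a; q ^ a)_∞` converges for `a ≥ 1`. -/
theorem multipliable_qProd (a : ℕ) (ha : 0 < a) :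
    Multipliable fun j : ℕ => (1 - ((X : ℚ⟦X⟧) ^ a) ^ (j + 1)) := by
  simp_rw [sub_eq_add_neg]
  apply PowerSeries.WithPiTopology.multipliable_one_add_of_tendsto_order_atTop_nhds_top
  refine ENat.tendsto_nhds_top_iff_natCast_lt.mpr fun n =>
    Filter.eventually_atTop.mpr ⟨n, fun m hm => ?_⟩
  rw [order_neg, ← pow_mul, order_X_pow]
  have : n < a * (m + 1) := by nlinarith
  exact_mod_cast this

/-- `(q ^ a; q ^ a)_∞` is invertible for `a ≥ 1`: its constant coefficient is `1`. -/
theorem constantCoeff_qProd (a : ℕ) (ha : 0 < a) :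
    constantCoeff (qProd ((X : ℚ⟦X⟧) ^ a)) = 1 := by
  rw [qProd, (multipliable_qProd a ha).map_tprod _
    (PowerSeries.WithPiTopology.continuous_constantCoeff ℚ)]
  simp [ha.ne']

end CoreGF

/-! Walk along the boundary of a diagram and number its unit steps by the integers; `betaSet`
records the positions of the vertical steps. A hook of length `h` is a pair `s ∈ betaSet μ`, `s - h
∉ betaSet μ`, so a `T`-core is a set stable under `s ↦ s - T` (`isCore_iff`). Self-conjugacy says
that `z ↦ -1 - z` exchanges the set with its complement; for doubled distinct partitions `z ↦ -z`
does so away from `0`, and `0` is absent. Either way the finite set `posBeta` determines the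
partition, of weight `∑ (2a + 1)`, respectively `∑ 2b`.

Joining the odd numbers `2a + 1` and the even numbers `2b` into one finite set `C`, whose sum is the
total weight, merges the two core conditions into one with modulus `2T` and reflection `c ↦ 2T - c`
(`isCoreSet_interlace_iff`). For `T = t + 1`, such a `C` amounts to `t` independent integers, one
for each pair of residues `±r` modulo `2T`, `1 ≤ r ≤ t` (`blockUnionEquiv`).

The generating function is therefore a product of `t` theta series, each evaluated by the Jacobi
triple product (`tsum_X_pow_blockSum`). Together they contribute the factors `1 + q^j` with `T ∤ j`
(`prod_apProd_mul`), and `(1 + x)(1 - x) = 1 - x²` gives the stated form. -/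

namespace CoreGF

/-! ### Beta-sets and the core condition -/

/-- The set of first column hook lengths, normalised so that the empty partition gives the
negative integers. -/
def betaSet (μ : YoungDiagram) : Set ℤ := Set.range fun i : ℕ => (μ.rowLen i : ℤ) - i - 1

/-- Every boundary step is either vertical, at the end of a row, or horizontal, at the foot of a
column. For a missing `z`, the first row whose label is at most `z` locates the column. -/
theorem notMem_betaSet_iff (μ : YoungDiagram) (z : ℤ) :
    z ∉ betaSet μ ↔ ∃ j : ℕ, z = j - (μ.colLen j : ℤ) := by
  constructor
  · intro hz
    have hex : ∃ i : ℕ, (μ.rowLen i : ℤ) - i - 1 ≤ z := by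
      refine ⟨(μ.rowLen 0 + z.natAbs), ?_⟩
      have := μ.rowLen_anti 0 (μ.rowLen 0 + z.natAbs) (Nat.zero_le _)
      omega
    classical
    have h1 := Nat.find_spec hex
    have h2 := fun k => Nat.find_min hex (m := k)
    set i := Nat.find hex
    have hne : (μ.rowLen i : ℤ) - i - 1 ≠ z := fun he => hz ⟨i, he⟩
    obtain ⟨j, hj⟩ : ∃ j : ℕ, (j : ℤ) = z + i := ⟨(z + i).toNat, by omega⟩
    refine ⟨j, ?_⟩
    have hle : μ.colLen j ≤ i := by
      by_contra hlt
      have := YoungDiagram.mem_iff_lt_rowLen.1 (YoungDiagram.mem_iff_lt_colLen.2 (not_le.1 hlt))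
      omega
    have hge : i ≤ μ.colLen j := by
      rcases Nat.eq_zero_or_pos i with h0 | h0
      · omega
      · have h3 := h2 (i - 1) (by omega)
        have := YoungDiagram.mem_iff_lt_colLen.1
          (YoungDiagram.mem_iff_lt_rowLen.2 (show j < μ.rowLen (i - 1) by omega))
        omega
    omega
  · rintro ⟨j, rfl⟩ ⟨i, hi⟩
    simp only at hi
    by_cases hm : (i, j) ∈ μ
    · have h1 := YoungDiagram.mem_iff_lt_rowLen.1 hm
      have h2 := YoungDiagram.mem_iff_lt_colLen.1 hm
      omega
    · have h1 : ¬ j < μ.rowLen i := fun h => hm (YoungDiagram.mem_iff_lt_rowLen.2 h)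
      have h2 : ¬ i < μ.colLen j := fun h => hm (YoungDiagram.mem_iff_lt_colLen.2 h)
      omega

/-- Splitting the hook into its arm (with the corner) and its leg shows that its length is the
distance between the two boundary steps at its ends. -/
theorem hookLength_eq (μ : YoungDiagram) {i j : ℕ} (hm : (i, j) ∈ μ) :
    (hookLength μ (i, j) : ℤ) = ((μ.rowLen i : ℤ) - i - 1) - (j - μ.colLen j) := by
  have h1 := YoungDiagram.mem_iff_lt_rowLen.1 hm
  have h2 := YoungDiagram.mem_iff_lt_colLen.1 hm
  have hh : hook μ (i, j) = (Finset.Ico j (μ.rowLen i)).image (fun b => (i, b)) ∪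
      (Finset.Ioo i (μ.colLen j)).image (fun a => (a, j)) := by
    ext ⟨a, b⟩
    simp only [hook, Finset.mem_filter, YoungDiagram.mem_cells, Finset.mem_union,
      Finset.mem_image, Finset.mem_Ico, Finset.mem_Ioo, Prod.mk.injEq]
    constructor
    · rintro ⟨hab, ⟨rfl, hb⟩ | ⟨rfl, ha⟩⟩
      · exact Or.inl ⟨b, ⟨hb, YoungDiagram.mem_iff_lt_rowLen.1 hab⟩, rfl, rfl⟩
      · rcases ha.eq_or_lt with rfl | ha
        · exact Or.inl ⟨b, ⟨le_rfl, h1⟩, rfl, rfl⟩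
        · exact Or.inr ⟨a, ⟨ha, YoungDiagram.mem_iff_lt_colLen.1 hab⟩, rfl, rfl⟩
    · rintro (⟨b', ⟨hb, hb'⟩, rfl, rfl⟩ | ⟨a', ⟨ha, ha'⟩, rfl, rfl⟩)
      · exact ⟨YoungDiagram.mem_iff_lt_rowLen.2 hb', Or.inl ⟨rfl, hb⟩⟩
      · exact ⟨YoungDiagram.mem_iff_lt_colLen.2 ha', Or.inr ⟨rfl, ha.le⟩⟩
  have hc : hookLength μ (i, j) = (μ.rowLen i - j) + (μ.colLen j - i - 1) := by
    rw [hookLength, hh, Finset.card_union_of_disjoint, Finset.card_image_of_injective,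
      Finset.card_image_of_injective, Nat.card_Ico, Nat.card_Ioo]
    · intro a b hab; simpa using hab
    · intro a b hab; simpa using hab
    · rw [Finset.disjoint_left]
      rintro ⟨a, b⟩ ha hb
      simp only [Finset.mem_image, Finset.mem_Ico, Finset.mem_Ioo, Prod.mk.injEq] at ha hb
      obtain ⟨_, _, h3, _⟩ := ha
      obtain ⟨_, _, h4, _⟩ := hb
      omega
  omega

/-- A failure of stability is a hook of length exactly `t`. Conversely, iterating stability `k`
times excludes hooks of length `t * k`. -/
theorem isCore_iff {t : ℕ} (ht : 0 < t) (μ : YoungDiagram) :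
    IsCore t μ ↔ ∀ s ∈ betaSet μ, s - t ∈ betaSet μ := by
  constructor
  · rintro hc _ ⟨i, rfl⟩
    by_contra hn
    obtain ⟨j, hj⟩ := (notMem_betaSet_iff μ _).1 hn
    simp only at hj
    have hm : (i, j) ∈ μ := by
      by_contra hm
      have h1 : ¬ j < μ.rowLen i := fun h => hm (YoungDiagram.mem_iff_lt_rowLen.2 h)
      have h2 : ¬ i < μ.colLen j := fun h => hm (YoungDiagram.mem_iff_lt_colLen.2 h)
      omega
    refine hc (i, j) hm ⟨1, ?_⟩
    have := hookLength_eq μ hm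
    omega
  · rintro hc ⟨i, j⟩ hm ⟨k, hk⟩
    have hk' : ∀ k : ℕ, ((μ.rowLen i : ℤ) - i - 1) - t * k ∈ betaSet μ := by
      intro k
      induction k with
      | zero => exact ⟨i, by simp⟩
      | succ k ih =>
        have := hc _ ih
        rwa [sub_sub, ← mul_add_one, ← Nat.cast_succ] at this
    refine (notMem_betaSet_iff μ _).2 ⟨j, ?_⟩ (hk' k)
    have := hookLength_eq μ hm
    rw [hk] at this
    push_cast at this
    linarith

theorem betaSet_injective : Function.Injective betaSet := by
  intro μ ν hμν
  -- The labels strictly decrease down the rows; negated, they form an increasing sequence, which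
  -- its range determines.
  have hmono : ∀ κ : YoungDiagram, StrictMono fun i : ℕ => -((κ.rowLen i : ℤ) - i - 1) := by
    intro κ i j hij
    have := κ.rowLen_anti i j hij.le
    show -((κ.rowLen i : ℤ) - i - 1) < -((κ.rowLen j : ℤ) - j - 1)
    omega
  have hr : ∀ κ : YoungDiagram,
      Set.range (fun i : ℕ => -((κ.rowLen i : ℤ) - i - 1)) = Neg.neg '' betaSet κ := by
    intro κ
    rw [betaSet, ← Set.range_comp]
    rfl
  have h1 := ((hmono μ).range_inj (hmono ν)).1 (by rw [hr, hr, hμν])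
  have h2 : ∀ i, μ.rowLen i = ν.rowLen i := by
    intro i
    have : -((μ.rowLen i : ℤ) - i - 1) = -((ν.rowLen i : ℤ) - i - 1) := congrFun h1 i
    omega
  ext ⟨i, j⟩
  simp only [YoungDiagram.mem_cells, YoungDiagram.mem_iff_lt_rowLen, h2]

/-! ### Nonnegative beta-numbers and sets of distinct parts -/

/-- The nonnegative elements of `betaSet`. -/
noncomputable def posBeta (μ : YoungDiagram) : Finset ℕ :=
  open Classical in (Finset.range (μ.rowLen 0)).filter fun b => (b : ℤ) ∈ betaSet μ

theorem mem_posBeta {μ : YoungDiagram} {b : ℕ} : b ∈ posBeta μ ↔ (b : ℤ) ∈ betaSet μ := by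
  simp only [posBeta, Finset.mem_filter, Finset.mem_range, and_iff_right_iff_imp]
  rintro ⟨i, hi⟩
  have := μ.rowLen_anti 0 i (Nat.zero_le _)
  simp only at hi
  omega

/-- The set of parts of a partition. -/
def parts (ν : YoungDiagram) : Finset ℕ := ν.rowLens.toFinset

theorem mem_parts {ν : YoungDiagram} {x : ℕ} :
    x ∈ parts ν ↔ ∃ i < ν.colLen 0, ν.rowLen i = x := by
  simp [parts, YoungDiagram.rowLens]

theorem rowLen_pos_iff {ν : YoungDiagram} {i : ℕ} : 0 < ν.rowLen i ↔ i < ν.colLen 0 := by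
  rw [← YoungDiagram.mem_iff_lt_rowLen, YoungDiagram.mem_iff_lt_colLen]

theorem HasDistinctParts.injOn {ν : YoungDiagram} (h : HasDistinctParts ν) :
    Set.InjOn ν.rowLen (Finset.range (ν.colLen 0)) := by
  rw [HasDistinctParts, YoungDiagram.rowLens, List.nodup_map_iff_inj_on List.nodup_range] at h
  intro i hi j hj hij
  exact h i (by simpa using hi) j (by simpa using hj) hij

theorem HasDistinctParts.sum_parts {M : Type*} [AddCommMonoid M] {ν : YoungDiagram}
    (h : HasDistinctParts ν) (f : ℕ → M) :
    ∑ x ∈ parts ν, f x = ∑ i ∈ Finset.range (ν.colLen 0), f (ν.rowLen i) := by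
  have : parts ν = (Finset.range (ν.colLen 0)).image ν.rowLen := by
    ext x; simp [mem_parts]
  rw [this, Finset.sum_image h.injOn]

theorem card_eq_sum_rowLen (ν : YoungDiagram) :
    ν.card = ∑ i ∈ Finset.range (ν.colLen 0), ν.rowLen i := by
  rw [YoungDiagram.card, Finset.card_eq_sum_card_fiberwise (f := Prod.fst)
    (t := Finset.range (ν.colLen 0))]
  · exact Finset.sum_congr rfl fun i _ => (ν.rowLen_eq_card).symm
  · rintro ⟨i, j⟩ hm
    simp only [Finset.coe_range, Set.mem_Iio]
    exact YoungDiagram.mem_iff_lt_colLen.1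
      (ν.up_left_mem le_rfl (Nat.zero_le j) (YoungDiagram.mem_cells _ |>.1 hm))

theorem exists_parts_eq (B : Finset ℕ) (hB : 0 ∉ B) :
    ∃ ν : YoungDiagram, HasDistinctParts ν ∧ parts ν = B := by
  have hs : (B.sort (· ≥ ·)).SortedGE := (B.pairwise_sort (· ≥ ·)).sortedGE
  have hpos : ∀ x ∈ B.sort (· ≥ ·), 0 < x := by
    intro x hx
    rw [Finset.mem_sort] at hx
    exact Nat.pos_of_ne_zero fun h0 => hB (h0 ▸ hx)
  refine ⟨YoungDiagram.ofRowLens _ hs, ?_, ?_⟩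
  · rw [HasDistinctParts, YoungDiagram.rowLens_ofRowLens_eq_self hpos]
    exact B.sort_nodup _
  · rw [parts, YoungDiagram.rowLens_ofRowLens_eq_self hpos, Finset.sort_toFinset]

/-! ### Doubled distinct partitions -/

theorem mem_doubled {ν : YoungDiagram} (h : HasDistinctParts ν) {a b : ℕ} :
    (a, b) ∈ doubled ν h ↔ (a < b ∧ (a, b - a - 1) ∈ ν) ∨ (b ≤ a ∧ (b, a - b) ∈ ν) := by
  rw [← mem_doubled_iff]; rfl

theorem card_doubled {ν : YoungDiagram} (h : HasDistinctParts ν) :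
    (doubled ν h).card = 2 * ν.card := by
  have : (doubled ν h).card = (shiftedCells ν ∪ addedCells ν).card := rfl
  rw [this, Finset.card_union_of_disjoint, shiftedCells, addedCells,
    Finset.card_image_of_injective, Finset.card_image_of_injective, YoungDiagram.card, two_mul]
  · rintro ⟨a, b⟩ ⟨c, d⟩ hh
    simp only [Prod.mk.injEq] at hh ⊢
    omega
  · rintro ⟨a, b⟩ ⟨c, d⟩ hh
    simp only [Prod.mk.injEq] at hh ⊢
    omega
  · rw [Finset.disjoint_left]
    rintro ⟨a, b⟩ ha hb
    simp only [shiftedCells, addedCells, Finset.mem_image, Prod.mk.injEq] at ha hb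
    obtain ⟨_, _, h1, h2⟩ := ha
    obtain ⟨_, _, h3, h4⟩ := hb
    omega

theorem rowLen_doubled {ν : YoungDiagram} (h : HasDistinctParts ν) {i : ℕ}
    (hi : i < ν.colLen 0) : (doubled ν h).rowLen i = i + 1 + ν.rowLen i := by
  have hp := rowLen_pos_iff.2 hi
  have h1 : (i, i + ν.rowLen i) ∈ doubled ν h := (mem_doubled h).2 <| Or.inl
    ⟨by omega, YoungDiagram.mem_iff_lt_rowLen.2 (by omega)⟩
  have h2 : ¬ (i, i + 1 + ν.rowLen i) ∈ doubled ν h := by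
    rw [mem_doubled h]
    rintro (⟨_, h3⟩ | ⟨_, _⟩)
    · rw [YoungDiagram.mem_iff_lt_rowLen] at h3
      omega
    · omega
  rw [YoungDiagram.mem_iff_lt_rowLen] at h1 h2
  omega

theorem colLen_doubled {ν : YoungDiagram} (h : HasDistinctParts ν) {i : ℕ}
    (hi : i < ν.colLen 0) : (doubled ν h).colLen i = i + ν.rowLen i := by
  have hp := rowLen_pos_iff.2 hi
  have h1 : (i + ν.rowLen i - 1, i) ∈ doubled ν h := (mem_doubled h).2 <| Or.inr
    ⟨by omega, YoungDiagram.mem_iff_lt_rowLen.2 (by omega)⟩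
  have h2 : ¬ (i + ν.rowLen i, i) ∈ doubled ν h := by
    rw [mem_doubled h]
    rintro (⟨_, h3⟩ | ⟨_, h3⟩)
    · omega
    · rw [YoungDiagram.mem_iff_lt_rowLen] at h3
      omega
  rw [YoungDiagram.mem_iff_lt_colLen] at h1 h2
  omega

theorem diag_mem_doubled {ν : YoungDiagram} (h : HasDistinctParts ν) {i : ℕ} :
    (i, i) ∈ doubled ν h ↔ i < ν.colLen 0 := by
  rw [mem_doubled h, ← YoungDiagram.mem_iff_lt_colLen]
  simp

/-- Only rows that meet the main diagonal can have nonnegative labels, and there the label is `(i +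
1 + ν_i) - i - 1 = ν_i`. The columns that meet it give the missing labels `-ν_i` in the next lemma.
-/
theorem mem_betaSet_doubled {ν : YoungDiagram} (h : HasDistinctParts ν) {z : ℤ} (hz : 0 ≤ z) :
    z ∈ betaSet (doubled ν h) ↔ ∃ x ∈ parts ν, (x : ℤ) = z := by
  constructor
  · rintro ⟨i, rfl⟩
    have hi : i < ν.colLen 0 := by
      rw [← diag_mem_doubled h, YoungDiagram.mem_iff_lt_rowLen]
      simp only at hz
      omega
    exact ⟨ν.rowLen i, mem_parts.2 ⟨i, hi, rfl⟩, by simp only [rowLen_doubled h hi]; omega⟩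
  · rintro ⟨x, hx, rfl⟩
    obtain ⟨i, hi, rfl⟩ := mem_parts.1 hx
    exact ⟨i, by simp only [rowLen_doubled h hi]; omega⟩

theorem notMem_betaSet_doubled {ν : YoungDiagram} (h : HasDistinctParts ν) {z : ℤ} (hz : z < 0) :
    z ∉ betaSet (doubled ν h) ↔ ∃ x ∈ parts ν, (x : ℤ) = -z := by
  rw [notMem_betaSet_iff]
  constructor
  · rintro ⟨i, rfl⟩
    have hi : i < ν.colLen 0 := by
      rw [← diag_mem_doubled h, YoungDiagram.mem_iff_lt_colLen]
      omega
    exact ⟨ν.rowLen i, mem_parts.2 ⟨i, hi, rfl⟩, by rw [colLen_doubled h hi]; omega⟩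
  · rintro ⟨x, hx, hx'⟩
    obtain ⟨i, hi, rfl⟩ := mem_parts.1 hx
    exact ⟨i, by rw [colLen_doubled h hi]; omega⟩

theorem zero_notMem_parts (ν : YoungDiagram) : 0 ∉ parts ν := by
  intro h0
  obtain ⟨i, hi, h1⟩ := mem_parts.1 h0
  have := rowLen_pos_iff.2 hi
  omega

theorem posBeta_doubled {ν : YoungDiagram} (h : HasDistinctParts ν) :
    posBeta (doubled ν h) = parts ν := by
  ext x
  rw [mem_posBeta, mem_betaSet_doubled h (by omega)]
  simp

theorem zero_notMem_of_mem_DD {μ : YoungDiagram} (hμ : μ ∈ DD) : (0 : ℤ) ∉ betaSet μ := by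
  obtain ⟨ν, h, rfl⟩ := hμ
  rw [mem_betaSet_doubled h le_rfl]
  rintro ⟨x, hx, hx0⟩
  exact zero_notMem_parts ν (by simpa using (show x = 0 by omega) ▸ hx)

theorem neg_mem_betaSet_of_mem_DD {μ : YoungDiagram} (hμ : μ ∈ DD) {z : ℤ} (hz : z ≠ 0) :
    -z ∈ betaSet μ ↔ z ∉ betaSet μ := by
  obtain ⟨ν, h, rfl⟩ := hμ
  rcases lt_or_gt_of_ne hz with hz | hz
  · rw [notMem_betaSet_doubled h hz, mem_betaSet_doubled h (by omega)]
  · have := notMem_betaSet_doubled h (z := -z) (by omega)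
    rw [neg_neg, ← mem_betaSet_doubled h hz.le] at this
    tauto

theorem card_of_mem_DD {μ : YoungDiagram} (hμ : μ ∈ DD) :
    μ.card = ∑ b ∈ posBeta μ, 2 * b := by
  obtain ⟨ν, h, rfl⟩ := hμ
  rw [posBeta_doubled h, card_doubled h, h.sum_parts, card_eq_sum_rowLen, Finset.mul_sum]

theorem exists_DD (B : Finset ℕ) (hB : 0 ∉ B) : ∃ μ ∈ DD, posBeta μ = B := by
  obtain ⟨ν, h, rfl⟩ := exists_parts_eq B hB
  exact ⟨doubled ν h, ⟨ν, h, rfl⟩, posBeta_doubled h⟩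

/-! ### Self-conjugate partitions -/

/-- The self-conjugate partition whose diagram on and above the main diagonal is the shifted
diagram of `ν`. -/
def symmetrized (ν : YoungDiagram) (h : HasDistinctParts ν) : YoungDiagram where
  cells := ν.cells.image (fun c => (c.1, c.1 + c.2)) ∪ ν.cells.image fun c => (c.1 + c.2, c.1)
  isLowerSet := by
    have key : ∀ a b : ℕ, (a, b) ∈ (ν.cells.image (fun c => (c.1, c.1 + c.2)) ∪
        ν.cells.image fun c => (c.1 + c.2, c.1)) ↔
        (a ≤ b ∧ (a, b - a) ∈ ν) ∨ (b ≤ a ∧ (b, a - b) ∈ ν) := by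
      intro a b
      simp only [Finset.mem_union, Finset.mem_image, Prod.mk.injEq,
        Prod.exists, YoungDiagram.mem_cells]
      constructor
      · rintro (⟨i, j, h, rfl, rfl⟩ | ⟨i, j, h, rfl, rfl⟩)
        · exact Or.inl ⟨by omega, by rwa [Nat.add_sub_cancel_left]⟩
        · exact Or.inr ⟨by omega, by rwa [Nat.add_sub_cancel_left]⟩
      · rintro (⟨h, hm⟩ | ⟨h, hm⟩)
        · exact Or.inl ⟨_, _, hm, rfl, by omega⟩
        · exact Or.inr ⟨_, _, hm, by omega, rfl⟩
    rintro ⟨a, b⟩ ⟨a', b'⟩ ⟨ha, hb⟩ hm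
    simp only at ha hb
    rw [Finset.mem_coe, key] at hm ⊢
    rcases le_total a' b' with hc | hc
    · refine Or.inl ⟨hc, ?_⟩
      rcases hm with ⟨_, hm⟩ | ⟨_, hm⟩
      · exact h.mem_of_le hm ha (by omega)
      · exact h.mem_of_le hm (by omega) (by omega)
    · refine Or.inr ⟨hc, ?_⟩
      rcases hm with ⟨_, hm⟩ | ⟨_, hm⟩
      · exact h.mem_of_le hm (by omega) (by omega)
      · exact h.mem_of_le hm hb (by omega)

theorem mem_symmetrized {ν : YoungDiagram} (h : HasDistinctParts ν) {a b : ℕ} :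
    (a, b) ∈ symmetrized ν h ↔ (a ≤ b ∧ (a, b - a) ∈ ν) ∨ (b ≤ a ∧ (b, a - b) ∈ ν) := by
  rw [← YoungDiagram.mem_cells, symmetrized]
  simp only [Finset.mem_union, Finset.mem_image, Prod.mk.injEq,
    Prod.exists, YoungDiagram.mem_cells]
  constructor
  · rintro (⟨i, j, h, rfl, rfl⟩ | ⟨i, j, h, rfl, rfl⟩)
    · exact Or.inl ⟨by omega, by rwa [Nat.add_sub_cancel_left]⟩
    · exact Or.inr ⟨by omega, by rwa [Nat.add_sub_cancel_left]⟩
  · rintro (⟨h, hm⟩ | ⟨h, hm⟩)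
    · exact Or.inl ⟨_, _, hm, rfl, by omega⟩
    · exact Or.inr ⟨_, _, hm, by omega, rfl⟩

theorem transpose_symmetrized {ν : YoungDiagram} (h : HasDistinctParts ν) :
    (symmetrized ν h).transpose = symmetrized ν h := by
  ext ⟨a, b⟩
  simp only [YoungDiagram.mem_cells, YoungDiagram.mem_transpose, Prod.swap_prod_mk,
    mem_symmetrized h]
  exact or_comm

/-- The two reflected copies of `ν` overlap exactly in the main diagonal, which has one box for each
part. -/
theorem card_symmetrized {ν : YoungDiagram} (h : HasDistinctParts ν) :
    (symmetrized ν h).card + ν.colLen 0 = 2 * ν.card := by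
  have h1 : (symmetrized ν h).card = (ν.cells.image (fun c => (c.1, c.1 + c.2)) ∪
    ν.cells.image fun c => (c.1 + c.2, c.1)).card := rfl
  have h2 : ν.cells.image (fun c => (c.1, c.1 + c.2)) ∩ ν.cells.image (fun c => (c.1 + c.2, c.1))
      = (Finset.range (ν.colLen 0)).image fun i => (i, i) := by
    ext ⟨a, b⟩
    simp only [Finset.mem_inter, Finset.mem_image, Prod.exists, Prod.mk.injEq, Finset.mem_range,
      YoungDiagram.mem_cells]
    constructor
    · rintro ⟨⟨i, j, hm, rfl, rfl⟩, ⟨i', j', _, h3, h4⟩⟩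
      obtain rfl : j = 0 := by omega
      exact ⟨i, YoungDiagram.mem_iff_lt_colLen.1 hm, rfl, rfl⟩
    · rintro ⟨i, hi, rfl, rfl⟩
      have := YoungDiagram.mem_iff_lt_colLen.2 hi
      exact ⟨⟨i, 0, this, rfl, rfl⟩, ⟨i, 0, this, rfl, rfl⟩⟩
  have h3 : ν.colLen 0 = ((Finset.range (ν.colLen 0)).image fun i => (i, i)).card := by
    rw [Finset.card_image_of_injective _ (fun a b hab => by simpa using hab), Finset.card_range]
  have h4 : (symmetrized ν h).card + ν.colLen 0 = (symmetrized ν h).card +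
      ((Finset.range (ν.colLen 0)).image fun i => (i, i)).card := by rw [← h3]
  rw [h4, h1, ← h2, Finset.card_union_add_card_inter, Finset.card_image_of_injective,
    Finset.card_image_of_injective, YoungDiagram.card, two_mul]
  · rintro ⟨a, b⟩ ⟨c, d⟩ hh
    simp only [Prod.mk.injEq] at hh ⊢
    omega
  · rintro ⟨a, b⟩ ⟨c, d⟩ hh
    simp only [Prod.mk.injEq] at hh ⊢
    omega

theorem mem_betaSet_symmetrized {ν : YoungDiagram} (h : HasDistinctParts ν) {z : ℤ}
    (hz : 0 ≤ z) : z ∈ betaSet (symmetrized ν h) ↔ ∃ x ∈ parts ν, (x : ℤ) = z + 1 := by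
  have hrow : ∀ i < ν.colLen 0, (symmetrized ν h).rowLen i = i + ν.rowLen i := by
    intro i hi
    have hp := rowLen_pos_iff.2 hi
    have h1 : (i, i + ν.rowLen i - 1) ∈ symmetrized ν h := (mem_symmetrized h).2 <| Or.inl
      ⟨by omega, YoungDiagram.mem_iff_lt_rowLen.2 (by omega)⟩
    have h2 : ¬ (i, i + ν.rowLen i) ∈ symmetrized ν h := by
      rw [mem_symmetrized h]
      rintro (⟨_, h3⟩ | ⟨_, h3⟩)
      · rw [YoungDiagram.mem_iff_lt_rowLen] at h3
        omega
      · omega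
    rw [YoungDiagram.mem_iff_lt_rowLen] at h1 h2
    omega
  constructor
  · rintro ⟨i, rfl⟩
    simp only at hz
    have hi : (i, i) ∈ symmetrized ν h := YoungDiagram.mem_iff_lt_rowLen.2 (by omega)
    have hi : i < ν.colLen 0 := by
      rw [mem_symmetrized h] at hi
      simpa [YoungDiagram.mem_iff_lt_colLen] using hi
    exact ⟨ν.rowLen i, mem_parts.2 ⟨i, hi, rfl⟩, by simp only [hrow i hi]; omega⟩
  · rintro ⟨x, hx, hx'⟩
    obtain ⟨i, hi, rfl⟩ := mem_parts.1 hx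
    exact ⟨i, by simp only [hrow i hi]; omega⟩

/-- Transposition reverses the boundary path and swaps vertical with horizontal steps. -/
theorem neg_mem_betaSet_of_transpose_eq {μ : YoungDiagram} (hμ : μ.transpose = μ) (z : ℤ) :
    -1 - z ∈ betaSet μ ↔ z ∉ betaSet μ := by
  rw [notMem_betaSet_iff]
  have : ∀ j, μ.colLen j = μ.rowLen j := fun j => by rw [← YoungDiagram.colLen_transpose, hμ]
  simp only [this, betaSet, Set.mem_range]
  exact ⟨fun ⟨i, hi⟩ => ⟨i, by omega⟩, fun ⟨i, hi⟩ => ⟨i, by omega⟩⟩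

theorem eq_of_transpose_eq_of_posBeta_eq {μ ν : YoungDiagram} (hμ : μ.transpose = μ)
    (hν : ν.transpose = ν) (hp : posBeta μ = posBeta ν) : μ = ν := by
  have key : ∀ z : ℤ, 0 ≤ z → (z ∈ betaSet μ ↔ z ∈ betaSet ν) := by
    intro z hz
    lift z to ℕ using hz
    rw [← mem_posBeta, ← mem_posBeta, hp]
  refine betaSet_injective (Set.ext fun z => ?_)
  rcases le_or_gt 0 z with hz | hz
  · exact key z hz
  · have h1 := neg_mem_betaSet_of_transpose_eq hμ z
    have h2 := neg_mem_betaSet_of_transpose_eq hν z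
    have h3 := key (-1 - z) (by omega)
    tauto

theorem eq_of_mem_DD_of_posBeta_eq {μ ν : YoungDiagram} (hμ : μ ∈ DD)
    (hν : ν ∈ DD) (hp : posBeta μ = posBeta ν) : μ = ν := by
  have key : ∀ z : ℤ, 0 ≤ z → (z ∈ betaSet μ ↔ z ∈ betaSet ν) := by
    intro z hz
    lift z to ℕ using hz
    rw [← mem_posBeta, ← mem_posBeta, hp]
  refine betaSet_injective (Set.ext fun z => ?_)
  rcases le_or_gt 0 z with hz | hz
  · exact key z hz
  · have h1 := neg_mem_betaSet_of_mem_DD hμ hz.ne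
    have h2 := neg_mem_betaSet_of_mem_DD hν hz.ne
    have h3 := key (-z) (by omega)
    tauto

/-- The diagonal labels of a symmetrized diagram are `ν_i - 1`, so `ν` must have parts `a + 1`. The
weight is recorded here because uniqueness then transfers it to every self-conjugate diagram. -/
theorem exists_symmetrized (A : Finset ℕ) : ∃ (ν : YoungDiagram) (h : HasDistinctParts ν),
    posBeta (symmetrized ν h) = A ∧ (symmetrized ν h).card = ∑ a ∈ A, (2 * a + 1) := by
  obtain ⟨ν, h, hA⟩ := exists_parts_eq (A.image (· + 1)) (by simp)
  have hsum := h.sum_parts (fun x => 2 * x)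
  rw [hA, Finset.sum_image (by simp), ← Finset.mul_sum (Finset.range _),
    ← card_eq_sum_rowLen] at hsum
  have hlen := h.sum_parts (fun _ => 1)
  rw [hA, Finset.sum_image (by simp), Finset.sum_const (b := 1) (s := Finset.range _),
    Finset.card_range, smul_eq_mul, mul_one] at hlen
  refine ⟨ν, h, ?_, ?_⟩
  · ext x
    rw [mem_posBeta, mem_betaSet_symmetrized h (by omega), hA]
    simp only [Finset.mem_image, exists_exists_and_eq_and]
    constructor
    · rintro ⟨a, ha, ha'⟩
      obtain rfl : a = x := by push_cast at ha'; omega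
      exact ha
    · exact fun hx => ⟨x, hx, by push_cast; rfl⟩
  · have hc := card_symmetrized h
    rw [← hlen, ← hsum] at hc
    have : ∑ a ∈ A, (2 * a + 1) + ∑ a ∈ A, 1 = ∑ a ∈ A, 2 * (a + 1) := by
      rw [← Finset.sum_add_distrib]
      exact Finset.sum_congr rfl fun a _ => by ring
    omega

theorem exists_selfConjugate (A : Finset ℕ) :
    ∃ μ : YoungDiagram, μ.transpose = μ ∧ posBeta μ = A := by
  obtain ⟨ν, h, hA, _⟩ := exists_symmetrized A
  exact ⟨_, transpose_symmetrized h, hA⟩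

theorem card_of_transpose_eq {μ : YoungDiagram} (hμ : μ.transpose = μ) :
    μ.card = ∑ a ∈ posBeta μ, (2 * a + 1) := by
  obtain ⟨ν, h, hA, hc⟩ := exists_symmetrized (posBeta μ)
  rwa [eq_of_transpose_eq_of_posBeta_eq (transpose_symmetrized h) hμ hA] at hc

/-! ### The core condition on nonnegative beta-numbers -/

theorem isCore_iff_of_transpose_eq {T : ℕ} (hT : 0 < T) {μ : YoungDiagram}
    (hμ : μ.transpose = μ) : IsCore T μ ↔
      ∀ a ∈ posBeta μ, (T ≤ a → a - T ∈ posBeta μ) ∧ (a < T → T - 1 - a ∉ posBeta μ) := by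
  have hneg := neg_mem_betaSet_of_transpose_eq hμ
  rw [isCore_iff hT]
  constructor
  · intro hc a ha
    have h1 := hc _ (mem_posBeta.1 ha)
    refine ⟨fun hle => ?_, fun hlt => ?_⟩
    · rwa [mem_posBeta, Nat.cast_sub hle]
    · rw [mem_posBeta, ← hneg]
      convert h1 using 1
      omega
  · intro hc s hs
    rcases le_or_gt 0 s with h0 | h0
    · lift s to ℕ using h0
      obtain ⟨h1, h2⟩ := hc s (mem_posBeta.2 hs)
      rcases le_or_gt T s with h3 | h3
      · have := h1 h3
        rwa [mem_posBeta, Nat.cast_sub h3] at this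
      · have := h2 h3
        rw [mem_posBeta, ← hneg] at this
        convert this using 1
        omega
    -- For negative `s` the reflection turns stability into its contrapositive at `u`: if `u` is
    -- missing, so is `u + T`.
    · obtain ⟨u, hu⟩ : ∃ u : ℕ, (u : ℤ) = -1 - s := ⟨(-1 - s).toNat, by omega⟩
      have h1 : (u : ℤ) ∉ betaSet μ := by
        rw [← hneg, hu]
        convert hs using 1
        omega
      have h2 : ((u + T : ℕ) : ℤ) ∉ betaSet μ := by
        intro h3
        have h4 := (hc (u + T) (mem_posBeta.2 h3)).1 (by omega)
        rw [Nat.add_sub_cancel, mem_posBeta] at h4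
        exact h1 h4
      rw [← hneg] at h2
      convert h2 using 1
      push_cast
      omega

theorem isCore_iff_of_mem_DD {T : ℕ} (hT : 0 < T) {μ : YoungDiagram}
    (hμ : μ ∈ DD) : IsCore T μ ↔
      ∀ b ∈ posBeta μ, b ≠ T ∧ (T < b → b - T ∈ posBeta μ) ∧ (b < T → T - b ∉ posBeta μ) := by
  have hneg := fun {z : ℤ} => neg_mem_betaSet_of_mem_DD hμ (z := z)
  have hz := zero_notMem_of_mem_DD hμ
  rw [isCore_iff hT]
  constructor
  · intro hc b hb
    have h1 := hc _ (mem_posBeta.1 hb)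
    refine ⟨?_, fun hle => ?_, fun hlt => ?_⟩
    · rintro rfl
      rw [sub_self] at h1
      exact hz h1
    · rwa [mem_posBeta, Nat.cast_sub hle.le]
    · rw [mem_posBeta, ← hneg (by omega)]
      convert h1 using 1
      omega
  · intro hc s hs
    have hs0 : s ≠ 0 := by rintro rfl; exact hz hs
    rcases le_or_gt 0 s with h0 | h0
    · lift s to ℕ using h0
      obtain ⟨h1, h2, h3⟩ := hc s (mem_posBeta.2 hs)
      rcases lt_or_gt_of_ne h1 with h4 | h4
      · have := h3 h4
        rw [mem_posBeta, ← hneg (by omega)] at this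
        convert this using 1
        omega
      · have := h2 h4
        rwa [mem_posBeta, Nat.cast_sub h4.le] at this
    · obtain ⟨u, hu⟩ : ∃ u : ℕ, (u : ℤ) = - s := ⟨(-s).toNat, by omega⟩
      have h1 : (u : ℤ) ∉ betaSet μ := by
        rw [← hneg (by omega), hu, neg_neg]
        exact hs
      have h2 : ((u + T : ℕ) : ℤ) ∉ betaSet μ := by
        intro h3
        have h4 := (hc (u + T) (mem_posBeta.2 h3)).2.1 (by omega)
        rw [Nat.add_sub_cancel, mem_posBeta] at h4
        exact h1 h4
      rw [← hneg (by omega)] at h2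
      convert h2 using 1
      push_cast
      omega

/-! ### Merging a pair of cores into one finite set -/

/-- The condition that characterises, among the finite sets of natural numbers, the sets
`{2 a + 1 : a ∈ posBeta μ₁} ∪ {2 b : b ∈ posBeta μ₂}` coming from pairs of `T`-cores. -/
structure IsCoreSet (T : ℕ) (C : Finset ℕ) : Prop where
  zero_notMem : 0 ∉ C
  two_mul_notMem : 2 * T ∉ C
  sub_mem : ∀ c ∈ C, 2 * T < c → c - 2 * T ∈ C
  sub_notMem : ∀ c ∈ C, c < 2 * T → 2 * T - c ∉ C

/-- The finite set with odd elements given by `A` and even elements given by `B`. -/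
def interlace (A B : Finset ℕ) : Finset ℕ :=
  A.image (fun a => 2 * a + 1) ∪ B.image fun b => 2 * b

theorem odd_mem_interlace {A B : Finset ℕ} {a : ℕ} : 2 * a + 1 ∈ interlace A B ↔ a ∈ A := by
  simp only [interlace, Finset.mem_union, Finset.mem_image]
  constructor
  · rintro (⟨b, hb, h⟩ | ⟨b, hb, h⟩)
    · rwa [show a = b by omega]
    · omega
  · exact fun h => Or.inl ⟨a, h, rfl⟩

theorem even_mem_interlace {A B : Finset ℕ} {b : ℕ} : 2 * b ∈ interlace A B ↔ b ∈ B := by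
  simp only [interlace, Finset.mem_union, Finset.mem_image]
  constructor
  · rintro (⟨c, hc, h⟩ | ⟨c, hc, h⟩)
    · omega
    · rwa [show b = c by omega]
  · exact fun h => Or.inr ⟨b, h, rfl⟩

theorem sum_interlace (A B : Finset ℕ) :
    ∑ c ∈ interlace A B, c = ∑ a ∈ A, (2 * a + 1) + ∑ b ∈ B, 2 * b := by
  rw [interlace, Finset.sum_union, Finset.sum_image (by intro a _ b _ h; simpa using h),
    Finset.sum_image (by intro a _ b _ h; simpa using h)]
  rw [Finset.disjoint_left]
  intro c h1 h2
  simp only [Finset.mem_image] at h1 h2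
  omega

theorem interlace_injective {A B A' B' : Finset ℕ} (h : interlace A B = interlace A' B') :
    A = A' ∧ B = B' :=
  ⟨Finset.ext fun a => by rw [← odd_mem_interlace (B := B), h, odd_mem_interlace],
    Finset.ext fun b => by rw [← even_mem_interlace (A := A), h, even_mem_interlace]⟩

theorem exists_interlace (C : Finset ℕ) : ∃ A B, interlace A B = C := by
  refine ⟨(Finset.range (C.sup id + 1)).filter fun a => 2 * a + 1 ∈ C,
    (Finset.range (C.sup id + 1)).filter fun b => 2 * b ∈ C, ?_⟩
  ext c
  have hs : c ∈ C → c ≤ C.sup id := fun h => Finset.le_sup (f := id) h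
  rcases Nat.even_or_odd' c with ⟨k, rfl | rfl⟩
  · rw [even_mem_interlace, Finset.mem_filter, Finset.mem_range, and_iff_right_iff_imp]
    intro h; have := hs h; omega
  · rw [odd_mem_interlace, Finset.mem_filter, Finset.mem_range, and_iff_right_iff_imp]
    intro h; have := hs h; omega

/-- Under `a ↦ 2a + 1` and `b ↦ 2b` the different reflections `T - 1 - a` and `T - b` both become `c
↦ 2T - c`, and both shifts by `T` become shifts by `2T`. -/
theorem isCoreSet_interlace_iff {T : ℕ} {A B : Finset ℕ} (hB : 0 ∉ B) :
    IsCoreSet T (interlace A B) ↔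
      (∀ a ∈ A, (T ≤ a → a - T ∈ A) ∧ (a < T → T - 1 - a ∉ A)) ∧
      ∀ b ∈ B, b ≠ T ∧ (T < b → b - T ∈ B) ∧ (b < T → T - b ∉ B) := by
  constructor
  · rintro ⟨h0, h1, h2, h3⟩
    refine ⟨fun a ha => ⟨fun hle => ?_, fun hlt => ?_⟩, fun b hb => ⟨?_, fun hle => ?_,
      fun hlt => ?_⟩⟩
    · have := h2 _ (odd_mem_interlace.2 ha) (by omega)
      rwa [show 2 * a + 1 - 2 * T = 2 * (a - T) + 1 by omega, odd_mem_interlace] at this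
    · have := h3 _ (odd_mem_interlace.2 ha) (by omega)
      rwa [show 2 * T - (2 * a + 1) = 2 * (T - 1 - a) + 1 by omega, odd_mem_interlace] at this
    · rintro rfl
      exact h1 (even_mem_interlace.2 hb)
    · have := h2 _ (even_mem_interlace.2 hb) (by omega)
      rwa [← Nat.mul_sub, even_mem_interlace] at this
    · have := h3 _ (even_mem_interlace.2 hb) (by omega)
      rwa [← Nat.mul_sub, even_mem_interlace] at this
  · rintro ⟨hA, hB'⟩
    refine ⟨?_, ?_, fun c hc hlt => ?_, fun c hc hlt => ?_⟩
    · rwa [show 0 = 2 * 0 from rfl, even_mem_interlace]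
    · rw [even_mem_interlace]
      exact fun h => (hB' _ h).1 rfl
    · rcases Nat.even_or_odd' c with ⟨k, rfl | rfl⟩
      · rw [even_mem_interlace] at hc
        rw [← Nat.mul_sub, even_mem_interlace]
        exact (hB' _ hc).2.1 (by omega)
      · rw [odd_mem_interlace] at hc
        rw [show 2 * k + 1 - 2 * T = 2 * (k - T) + 1 by omega, odd_mem_interlace]
        exact (hA _ hc).1 (by omega)
    · rcases Nat.even_or_odd' c with ⟨k, rfl | rfl⟩
      · rw [even_mem_interlace] at hc
        rw [← Nat.mul_sub, even_mem_interlace]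
        exact (hB' _ hc).2.2 (by omega)
      · rw [odd_mem_interlace] at hc
        rw [show 2 * T - (2 * k + 1) = 2 * (T - 1 - k) + 1 by omega, odd_mem_interlace]
        exact (hA _ hc).2 (by omega)

theorem zero_notMem_posBeta {μ : YoungDiagram} (hμ : μ ∈ DD) : 0 ∉ posBeta μ := by
  rw [mem_posBeta]
  exact zero_notMem_of_mem_DD hμ

theorem isCoreSet_of_cores {T : ℕ} (hT : 0 < T) (p : SCcore T × DDcore T) :
    IsCoreSet T (interlace (posBeta p.1.1) (posBeta p.2.1)) := by
  rw [isCoreSet_interlace_iff (zero_notMem_posBeta p.2.2.2),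
    ← isCore_iff_of_transpose_eq hT p.1.2.2, ← isCore_iff_of_mem_DD hT p.2.2.2]
  exact ⟨p.1.2.1, p.2.2.1⟩

/-- Pairs of a self-conjugate and a doubled distinct `T`-core, encoded as finite sets. -/
noncomputable def coreSetEquiv {T : ℕ} (hT : 0 < T) :
    SCcore T × DDcore T ≃ {C : Finset ℕ // IsCoreSet T C} :=
  Equiv.ofBijective (fun p => ⟨interlace (posBeta p.1.1) (posBeta p.2.1), isCoreSet_of_cores hT p⟩)
    (by
      constructor
      · rintro ⟨⟨μ₁, h₁⟩, ⟨μ₂, h₂⟩⟩ ⟨⟨ν₁, k₁⟩, ⟨ν₂, k₂⟩⟩ h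
        obtain ⟨h3, h4⟩ := interlace_injective (Subtype.ext_iff.1 h)
        obtain rfl := eq_of_transpose_eq_of_posBeta_eq h₁.2 k₁.2 h3
        obtain rfl := eq_of_mem_DD_of_posBeta_eq h₂.2 k₂.2 h4
        rfl
      · rintro ⟨C, hC⟩
        obtain ⟨A, B, rfl⟩ := exists_interlace C
        have hB : 0 ∉ B := fun h => hC.zero_notMem (even_mem_interlace (A := A).2 h)
        have hC' := hC
        rw [isCoreSet_interlace_iff hB] at hC'
        obtain ⟨μ, hμ, rfl⟩ := exists_selfConjugate A
        obtain ⟨ν, hν, rfl⟩ := exists_DD B hB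
        rw [← isCore_iff_of_transpose_eq hT hμ, ← isCore_iff_of_mem_DD hT hν] at hC'
        exact ⟨⟨⟨μ, hC'.1, hμ⟩, ⟨ν, hC'.2, hν⟩⟩, rfl⟩)

theorem sum_coreSetEquiv {T : ℕ} (hT : 0 < T) (p : SCcore T × DDcore T) :
    ∑ c ∈ (coreSetEquiv hT p).1, c = p.1.1.card + p.2.1.card := by
  have : (coreSetEquiv hT p).1 = interlace (posBeta p.1.1) (posBeta p.2.1) := rfl
  rw [this, sum_interlace, card_of_transpose_eq p.1.2.2, card_of_mem_DD p.2.2.2]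

/-! ### Core sets as integer vectors -/

/-- The first `n` terms of the progression `a, a + m, …` if `n ≥ 0`, and the first `-n` terms of
`b, b + m, …` if `n ≤ 0`, where `m = a + b`. -/
def block (a b : ℕ) (n : ℤ) : Finset ℕ :=
  (Finset.range n.toNat).image (fun k => a + (a + b) * k) ∪
    (Finset.range (-n).toNat).image fun k => b + (a + b) * k

/-- The sum of the elements of `block a b n`. -/
def blockSum (a b : ℕ) (n : ℤ) : ℕ :=
  ∑ k ∈ Finset.range n.toNat, (a + (a + b) * k) + ∑ k ∈ Finset.range (-n).toNat, (b + (a + b) * k)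

theorem mem_block {a b : ℕ} {n : ℤ} {c : ℕ} : c ∈ block a b n ↔
    (∃ k : ℕ, (k : ℤ) < n ∧ a + (a + b) * k = c) ∨
      ∃ k : ℕ, (k : ℤ) < -n ∧ b + (a + b) * k = c := by
  simp only [block, Finset.mem_union, Finset.mem_image, Finset.mem_range, Int.lt_toNat]

theorem sum_block {a b : ℕ} (h : 0 < a + b) (n : ℤ) :
    ∑ c ∈ block a b n, c = blockSum a b n := by
  have hinj : ∀ r : ℕ, Function.Injective fun k => r + (a + b) * k := fun r k k' hk =>
    Nat.eq_of_mul_eq_mul_left h (Nat.add_left_cancel hk)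
  rw [block, Finset.sum_union, Finset.sum_image (hinj a).injOn, Finset.sum_image (hinj b).injOn,
    blockSum]
  rcases le_total 0 n with hn | hn
  · simp [Int.toNat_of_nonpos (show -n ≤ 0 by omega)]
  · simp [Int.toNat_of_nonpos hn]

theorem add_mul_inj {m r r' k k' : ℕ} (hr : r < m) (hr' : r' < m)
    (h : r + m * k = r' + m * k') : r = r' ∧ k = k' := by
  have h1 := congrArg (· % m) h
  simp only [Nat.add_mul_mod_self_left, Nat.mod_eq_of_lt hr, Nat.mod_eq_of_lt hr'] at h1
  subst h1
  exact ⟨rfl, Nat.eq_of_mul_eq_mul_left (by omega) (Nat.add_left_cancel h)⟩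

/-- The union of the blocks of the residue pairs `± (i + 1)` modulo `2 (t + 1)`. -/
def blockUnion {t : ℕ} (f : Fin t → ℤ) : Finset ℕ :=
  Finset.univ.biUnion fun i : Fin t => block (i + 1) (2 * (t + 1) - (i + 1)) (f i)

theorem mem_blockUnion {t : ℕ} {f : Fin t → ℤ} {c : ℕ} : c ∈ blockUnion f ↔
    ∃ i : Fin t, (∃ k : ℕ, (k : ℤ) < f i ∧ (i + 1) + (2 * (t + 1)) * k = c) ∨
      ∃ k : ℕ, (k : ℤ) < -f i ∧ (2 * (t + 1) - (i + 1)) + (2 * (t + 1)) * k = c := by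
  have h : ∀ i : Fin t, (i : ℕ) + 1 + (2 * (t + 1) - (i + 1)) = 2 * (t + 1) := fun i => by omega
  simp only [blockUnion, Finset.mem_biUnion, Finset.mem_univ, true_and, mem_block, h]

theorem low_mem_blockUnion {t : ℕ} {f : Fin t → ℤ} {i : Fin t} {k : ℕ} :
    ((i : ℕ) + 1) + (2 * (t + 1)) * k ∈ blockUnion f ↔ (k : ℤ) < f i := by
  rw [mem_blockUnion]
  constructor
  · rintro ⟨j, ⟨l, hl, h⟩ | ⟨l, hl, h⟩⟩
    · obtain ⟨h1, rfl⟩ := add_mul_inj (by omega) (by omega) h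
      obtain rfl : j = i := by ext; omega
      exact hl
    · obtain ⟨h1, rfl⟩ := add_mul_inj (by omega) (by omega) h
      omega
  · exact fun h => ⟨i, Or.inl ⟨k, h, rfl⟩⟩

theorem high_mem_blockUnion {t : ℕ} {f : Fin t → ℤ} {i : Fin t} {k : ℕ} :
    (2 * (t + 1) - ((i : ℕ) + 1)) + (2 * (t + 1)) * k ∈ blockUnion f ↔ (k : ℤ) < -f i := by
  rw [mem_blockUnion]
  constructor
  · rintro ⟨j, ⟨l, hl, h⟩ | ⟨l, hl, h⟩⟩
    · obtain ⟨h1, rfl⟩ := add_mul_inj (by omega) (by omega) h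
      omega
    · obtain ⟨h1, rfl⟩ := add_mul_inj (by omega) (by omega) h
      obtain rfl : j = i := by ext; omega
      exact hl
  · exact fun h => ⟨i, Or.inr ⟨k, h, rfl⟩⟩

theorem sum_blockUnion {t : ℕ} (f : Fin t → ℤ) : ∑ c ∈ blockUnion f, c =
    ∑ i : Fin t, blockSum (i + 1) (2 * (t + 1) - (i + 1)) (f i) := by
  rw [blockUnion, Finset.sum_biUnion]
  · exact Finset.sum_congr rfl fun i _ => sum_block (by omega) _
  · intro i _ j _ hij
    have h : ∀ i : Fin t, (i : ℕ) + 1 + (2 * (t + 1) - (i + 1)) = 2 * (t + 1) := fun i => by omega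
    have hij' : (i : ℕ) ≠ j := fun h => hij (Fin.ext h)
    rw [Function.onFun, Finset.disjoint_left]
    intro c h1 h2
    rw [mem_block, h] at h1 h2
    rcases h1 with ⟨k, _, h1⟩ | ⟨k, _, h1⟩ <;> rcases h2 with ⟨l, _, h2⟩ | ⟨l, _, h2⟩ <;>
    · have := (add_mul_inj (by omega) (by omega) (h1.trans h2.symm)).1
      omega

theorem isCoreSet_blockUnion {t : ℕ} (f : Fin t → ℤ) : IsCoreSet (t + 1) (blockUnion f) := by
  refine ⟨fun h => ?_, fun h => ?_, fun c hc hlt => ?_, fun c hc hlt => ?_⟩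
  · obtain ⟨i, ⟨k, _, h⟩ | ⟨k, _, h⟩⟩ := mem_blockUnion.1 h <;> omega
  · obtain ⟨i, ⟨k, _, h⟩ | ⟨k, _, h⟩⟩ := mem_blockUnion.1 h
    · have := add_mul_inj (r' := 0) (k' := 1) (by omega) (by omega)
        (h.trans (by omega : _ = 0 + 2 * (t + 1) * 1))
      omega
    · have := add_mul_inj (r' := 0) (k' := 1) (by omega) (by omega)
        (h.trans (by omega : _ = 0 + 2 * (t + 1) * 1))
      omega
  · obtain ⟨i, ⟨k, hk, rfl⟩ | ⟨k, hk, rfl⟩⟩ := mem_blockUnion.1 hc <;> rcases k with _ | k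
    · omega
    · rw [show (i : ℕ) + 1 + 2 * (t + 1) * (k + 1) - 2 * (t + 1) = i + 1 + 2 * (t + 1) * k by
        rw [mul_add_one (2 * (t + 1)) k]; omega, low_mem_blockUnion]
      push_cast at hk
      omega
    · omega
    · rw [show 2 * (t + 1) - ((i : ℕ) + 1) + 2 * (t + 1) * (k + 1) - 2 * (t + 1) =
        2 * (t + 1) - (i + 1) + 2 * (t + 1) * k by rw [mul_add_one (2 * (t + 1)) k]; omega, high_mem_blockUnion]
      push_cast at hk
      omega
  · obtain ⟨i, ⟨k, hk, rfl⟩ | ⟨k, hk, rfl⟩⟩ := mem_blockUnion.1 hc <;> rcases k with _ | k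
    · have := high_mem_blockUnion (f := f) (i := i) (k := 0)
      rw [mul_zero, add_zero] at this ⊢
      rw [this]
      omega
    · rw [mul_add_one (2 * (t + 1)) k] at hlt
      omega
    · have := low_mem_blockUnion (f := f) (i := i) (k := 0)
      rw [mul_zero, add_zero] at this ⊢
      rw [show 2 * (t + 1) - (2 * (t + 1) - ((i : ℕ) + 1)) = i + 1 by omega, this]
      omega
    · rw [mul_add_one (2 * (t + 1)) k] at hlt
      omega

theorem IsCoreSet.mem_of_le {T : ℕ} {C : Finset ℕ} (hC : IsCoreSet T C) {r : ℕ} (hr : 0 < r)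
    (k l : ℕ) (h : r + 2 * T * (k + l) ∈ C) : r + 2 * T * k ∈ C := by
  induction l with
  | zero => exact h
  | succ l ih =>
    refine ih ?_
    have := hC.sub_mem _ h (by rw [← add_assoc, mul_add_one]; omega)
    rwa [← add_assoc k, mul_add_one, ← add_assoc, Nat.add_sub_cancel] at this

/-- Stability under subtracting `2T`, together with finiteness, leaves an initial segment of each
progression. -/
theorem IsCoreSet.exists_iff_lt {T : ℕ} (hT : 0 < T) {C : Finset ℕ} (hC : IsCoreSet T C) {r : ℕ}
    (hr : 0 < r) : ∃ n : ℕ, ∀ k : ℕ, r + 2 * T * k ∈ C ↔ k < n := by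
  have hex : ∃ n : ℕ, r + 2 * T * n ∉ C := by
    refine ⟨C.sup id, fun h => ?_⟩
    have h1 : r + 2 * T * C.sup id ≤ C.sup id := Finset.le_sup (f := id) h
    have h2 : 1 * C.sup id ≤ 2 * T * C.sup id := Nat.mul_le_mul_right _ (by omega)
    omega
  refine ⟨Nat.find hex, fun k => ⟨fun h => ?_, fun h => not_not.1 (Nat.find_min hex h)⟩⟩
  by_contra hlt
  refine Nat.find_spec hex (hC.mem_of_le hr _ (k - Nat.find hex) ?_)
  rwa [show Nat.find hex + (k - Nat.find hex) = k by omega]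

/-- Write `T = t + 1`. A multiple of `2T` would descend to `0` or `2T`, and the class of `T` to `T`,
its own reflection; both classes are empty. Of two opposite classes one is empty, since their least
terms reflect to each other, so the difference `p i - q i` loses nothing. -/
theorem exists_blockUnion_eq {t : ℕ} {C : Finset ℕ} (hC : IsCoreSet (t + 1) C) :
    ∃ f : Fin t → ℤ, blockUnion f = C := by
  have hT := Nat.succ_pos t
  have h1 := fun i : Fin t => hC.exists_iff_lt hT (r := i + 1) (by omega)
  have h2 := fun i : Fin t => hC.exists_iff_lt hT (r := 2 * (t + 1) - (i + 1)) (by omega)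
  choose p hp using h1
  choose q hq using h2
  have hpq : ∀ i, p i = 0 ∨ q i = 0 := by
    intro i
    by_contra! h
    have h3 := (hp i 0).2 (by omega)
    have h4 := (hq i 0).2 (by omega)
    rw [mul_zero, add_zero] at h3 h4
    exact hC.sub_notMem _ h3 (by omega) h4
  refine ⟨fun i => p i - q i, Finset.ext fun c => ?_⟩
  have hc := Nat.mod_add_div c (2 * (t + 1))
  have hlt := Nat.mod_lt c (show 0 < 2 * (t + 1) by omega)
  set r := c % (2 * (t + 1))
  set k := c / (2 * (t + 1))
  have hcases : r = 0 ∨ r = t + 1 ∨ (∃ i : Fin t, r = i + 1) ∨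
      ∃ i : Fin t, r = 2 * (t + 1) - (i + 1) := by
    rcases Nat.eq_zero_or_pos r with h | h
    · exact Or.inl h
    · rcases lt_trichotomy r (t + 1) with h' | h' | h'
      · exact Or.inr (Or.inr (Or.inl ⟨⟨r - 1, by omega⟩, by simp only; omega⟩))
      · exact Or.inr (Or.inl h')
      · exact Or.inr (Or.inr (Or.inr ⟨⟨2 * (t + 1) - r - 1, by omega⟩, by simp only; omega⟩))
  clear_value r k
  rw [← hc]
  rcases hcases with h | h | ⟨i, h⟩ | ⟨i, h⟩ <;> rw [h]
  · refine iff_of_false (fun h3 => ?_) fun h3 => ?_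
    · obtain ⟨i, ⟨k', _, h3⟩ | ⟨k', _, h3⟩⟩ := mem_blockUnion.1 h3 <;>
      · have := (add_mul_inj (by omega) (by omega) h3).1
        omega
    · rcases k with _ | k
      · exact hC.zero_notMem h3
      · refine hC.two_mul_notMem ?_
        have := hC.mem_of_le (r := 2 * (t + 1)) (by omega) 0 k
        rw [mul_zero, add_zero, zero_add] at this
        refine this ?_
        rwa [zero_add, mul_add_one, add_comm] at h3
  · refine iff_of_false (fun h3 => ?_) fun h3 => ?_
    · obtain ⟨i, ⟨k', _, h3⟩ | ⟨k', _, h3⟩⟩ := mem_blockUnion.1 h3 <;>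
      · have := (add_mul_inj (by omega) (by omega) h3).1
        omega
    · have h4 := hC.mem_of_le (Nat.succ_pos t) 0 k (by rwa [zero_add])
      rw [mul_zero, add_zero] at h4
      refine hC.sub_notMem _ h4 (by omega) ?_
      rwa [show 2 * (t + 1) - (t + 1) = t + 1 by omega]
  · rw [low_mem_blockUnion, hp]
    have := hpq i
    omega
  · rw [high_mem_blockUnion, hq]
    have := hpq i
    omega

/-- Core sets are parametrised by integer vectors. -/
noncomputable def blockUnionEquiv (t : ℕ) :
    (Fin t → ℤ) ≃ {C : Finset ℕ // IsCoreSet (t + 1) C} :=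
  Equiv.ofBijective (fun f => ⟨blockUnion f, isCoreSet_blockUnion f⟩)
    (by
      constructor
      · intro f g h
        have h' : blockUnion f = blockUnion g := Subtype.ext_iff.1 h
        funext i
        have h1 : ∀ k : ℕ, (k : ℤ) < f i ↔ (k : ℤ) < g i := fun k => by
          rw [← low_mem_blockUnion, h', low_mem_blockUnion]
        have h2 : ∀ k : ℕ, (k : ℤ) < -f i ↔ (k : ℤ) < -g i := fun k => by
          rw [← high_mem_blockUnion, h', high_mem_blockUnion]
        have := h1 (f i).toNat
        have := h1 (g i).toNat
        have := h2 (-f i).toNat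
        have := h2 (-g i).toNat
        omega
      · rintro ⟨C, hC⟩
        obtain ⟨f, rfl⟩ := exists_blockUnion_eq hC
        exact ⟨f, rfl⟩)

theorem sum_blockUnionEquiv {t : ℕ} (f : Fin t → ℤ) : ∑ c ∈ (blockUnionEquiv t f).1, c =
    ∑ i : Fin t, blockSum (i + 1) (2 * (t + 1) - (i + 1)) (f i) :=
  sum_blockUnion f

/-! ### The exponents of the theta series -/

theorem blockSum_neg (a b : ℕ) (n : ℤ) : blockSum a b (-n) = blockSum b a n := by
  rw [blockSum, blockSum, neg_neg, add_comm a b, add_comm]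

theorem blockSum_natCast_succ (a b n : ℕ) :
    blockSum a b ((n : ℤ) + 1) = blockSum a b n + a + (a + b) * n := by
  have h1 : ((n : ℤ) + 1).toNat = n + 1 := by omega
  have h2 : (-((n : ℤ) + 1)).toNat = 0 := by omega
  have h3 : (-(n : ℤ)).toNat = 0 := by omega
  rw [blockSum, blockSum, h1, h2, h3, Int.toNat_natCast, Finset.sum_range_succ]
  simp only [Finset.range_zero, Finset.sum_empty, add_zero, add_assoc]

/-- One recurrence covers both signs because the exponent is the single quadratic `a n + (a + b) n
(n - 1) / 2`. -/
theorem blockSum_succ (a b : ℕ) (n : ℤ) :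
    (blockSum a b (n + 1) : ℤ) = blockSum a b n + a + (a + b) * n := by
  rcases le_or_gt 0 n with hn | hn
  · lift n to ℕ using hn
    rw [blockSum_natCast_succ]
    push_cast
    ring
  · obtain ⟨k, hk⟩ : ∃ k : ℕ, n = -((k : ℤ) + 1) := ⟨(-n - 1).toNat, by omega⟩
    have h1 : n + 1 = -(k : ℤ) := by omega
    rw [h1, hk, blockSum_neg, blockSum_neg, blockSum_natCast_succ]
    push_cast
    ring

theorem natAbs_le_blockSum {a b : ℕ} (ha : 0 < a) (hb : 0 < b) (n : ℤ) :
    n.natAbs ≤ blockSum a b n := by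
  have key : ∀ r k : ℕ, 0 < r → k ≤ ∑ i ∈ Finset.range k, (r + (a + b) * i) := by
    intro r k hr
    calc k = ∑ i ∈ Finset.range k, 1 := by simp
      _ ≤ _ := Finset.sum_le_sum fun i _ => by omega
  have h1 := key a n.toNat ha
  have h2 := key b (-n).toNat hb
  rw [blockSum]
  omega

/-! ### Tail products and the finite Jacobi triple product -/

/-- `∏_{i > k} (1 - X ^ (m i))`. -/
noncomputable def tailProd (m k : ℕ) : ℚ⟦X⟧ := ∏' i : ℕ, (1 - ((X : ℚ⟦X⟧) ^ m) ^ (k + i + 1))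

theorem multipliable_one_add_of_X_pow_dvd {f : ℕ → ℚ⟦X⟧} (hf : ∀ i, X ^ (i + 1) ∣ f i) :
    Multipliable fun i => 1 + f i := by
  apply PowerSeries.WithPiTopology.multipliable_one_add_of_tendsto_order_atTop_nhds_top
  refine ENat.tendsto_nhds_top_iff_natCast_lt.mpr fun n =>
    Filter.eventually_atTop.mpr ⟨n, fun k hk => ?_⟩
  have h1 := nat_le_order (f k) (k + 1) (X_pow_dvd_iff.1 (hf k))
  refine lt_of_lt_of_le ?_ h1
  exact_mod_cast Nat.lt_succ_of_le hk

theorem multipliable_tailProd {m : ℕ} (hm : 0 < m) (k : ℕ) :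
    Multipliable fun i : ℕ => (1 - ((X : ℚ⟦X⟧) ^ m) ^ (k + i + 1)) := by
  simp_rw [sub_eq_add_neg]
  refine multipliable_one_add_of_X_pow_dvd fun i => ?_
  rw [dvd_neg, ← pow_mul]
  exact pow_dvd_pow _ (by nlinarith)

theorem tailProd_zero (m : ℕ) : tailProd m 0 = qProd (X ^ m) := by
  simp [tailProd, qProd]

theorem qProd_X_pow_ne_zero {m : ℕ} (hm : 0 < m) : qProd (X ^ m) ≠ 0 := fun h => by
  simpa [h] using constantCoeff_qProd m hm

theorem tailProd_eq {m : ℕ} (hm : 0 < m) (k : ℕ) :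
    tailProd m k = (1 - (X ^ m) ^ (k + 1)) * tailProd m (k + 1) := by
  have h := multipliable_tailProd hm (k + 1)
  have he : (fun i : ℕ => (1 - ((X : ℚ⟦X⟧) ^ m) ^ (k + 1 + i + 1))) =
      fun i : ℕ => (1 - ((X : ℚ⟦X⟧) ^ m) ^ (k + (i + 1) + 1)) := by
    funext i
    rw [show k + 1 + i + 1 = k + (i + 1) + 1 by ring]
  rw [tailProd, tailProd, he]
  rw [he] at h
  exact tprod_eq_zero_mul' (f := fun i : ℕ => (1 - ((X : ℚ⟦X⟧) ^ m) ^ (k + i + 1))) h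

theorem X_pow_dvd_tailProd_sub_one {m : ℕ} (hm : 0 < m) (k : ℕ) :
    (X : ℚ⟦X⟧) ^ (k + 1) ∣ tailProd m k - 1 := by
  have hfin : ∀ N : ℕ, (X : ℚ⟦X⟧) ^ (k + 1) ∣
      ∏ i ∈ Finset.range N, (1 - ((X : ℚ⟦X⟧) ^ m) ^ (k + i + 1)) - 1 := by
    intro N
    induction N with
    | zero => simp
    | succ N ih =>
      rw [Finset.prod_range_succ, mul_sub, mul_one, sub_right_comm]
      refine dvd_sub ih (Dvd.dvd.mul_left ?_ _)
      rw [← pow_mul]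
      exact pow_dvd_pow _ (by nlinarith)
  rw [X_pow_dvd_iff]
  intro d hd
  have h1 := (multipliable_tailProd hm k).hasProd.tendsto_prod_nat
  have h2 := ((PowerSeries.WithPiTopology.continuous_coeff ℚ d).tendsto _).comp h1
  have h3 : (fun N => coeff d (∏ i ∈ Finset.range N, (1 - ((X : ℚ⟦X⟧) ^ m) ^ (k + i + 1))))
      = fun _ => coeff d (1 : ℚ⟦X⟧) := by
    funext N
    have := X_pow_dvd_iff.1 (hfin N) d hd
    rwa [map_sub, sub_eq_zero] at this
  rw [Function.comp_def, h3] at h2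
  rw [map_sub, sub_eq_zero, tailProd]
  exact tendsto_nhds_unique h2 tendsto_const_nhds

/-- `tailProd` extended by `0` to negative arguments. -/
noncomputable def extTail (m : ℕ) (k : ℤ) : ℚ⟦X⟧ := if k < 0 then 0 else tailProd m k.toNat

theorem extTail_of_neg {m : ℕ} {k : ℤ} (hk : k < 0) : extTail m k = 0 := if_pos hk

theorem extTail_natCast (m k : ℕ) : extTail m k = tailProd m k := by
  simp [extTail]

/-- The extension by `0` is consistent at `k = 0`, where the factor `1 - (X ^ m) ^ 0` vanishes. -/
theorem extTail_sub_one {m : ℕ} (hm : 0 < m) (k : ℕ) :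
    extTail m ((k : ℤ) - 1) = (1 - (X ^ m) ^ k) * extTail m k := by
  rcases k with _ | k
  · rw [extTail_of_neg (by simp)]
    simp
  · rw [Nat.cast_succ, add_sub_cancel_right, ← Nat.cast_succ, extTail_natCast, extTail_natCast,
      tailProd_eq hm]

/-- The terms of a finite form of the Jacobi triple product. -/
noncomputable def tripleTerm (a b N M : ℕ) (n : ℤ) : ℚ⟦X⟧ :=
  X ^ blockSum a b n * extTail (a + b) (N - n) * extTail (a + b) (M + n)

theorem tripleTerm_swap (a b N M : ℕ) (n : ℤ) :
    tripleTerm a b N M n = tripleTerm b a M N (-n) := by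
  rw [tripleTerm, tripleTerm, blockSum_neg, add_comm b a, sub_neg_eq_add, ← sub_eq_add_neg]
  ring

theorem tripleTerm_eq_zero {a b N M : ℕ} {n : ℤ} (h : n < -M ∨ N < n) :
    tripleTerm a b N M n = 0 := by
  rcases h with h | h
  · rw [tripleTerm, extTail_of_neg (k := M + n) (by omega), mul_zero]
  · rw [tripleTerm, extTail_of_neg (k := N - n) (by omega), mul_zero, zero_mul]

theorem support_tripleTerm_subset (a b N M : ℕ) :
    Function.support (tripleTerm a b N M) ⊆ Finset.Icc (-(M : ℤ)) N := by
  intro n hn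
  rw [Finset.coe_Icc, Set.mem_Icc]
  by_contra h
  exact hn (tripleTerm_eq_zero (by omega))

theorem finite_support_tripleTerm (a b N M : ℕ) :
    (Function.support (tripleTerm a b N M)).Finite :=
  (Finset.finite_toSet _).subset (support_tripleTerm_subset a b N M)

/-- This is the `q`-Pascal rule, with tail products in place of reciprocals of finite products. With
`Q = X ^ (a + b)`, `p = N + 1 - n` and `q = M + n` it reads `1 - Q ^ (p + q) = (1 - Q ^ p) + Q ^ p
(1 - Q ^ q)`. -/
theorem tripleTerm_succ {a b : ℕ} (hm : 0 < a + b) (N M : ℕ) (n : ℤ) :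
    tripleTerm a b (N + 1) M n * (1 - (X ^ (a + b)) ^ (N + M + 1)) =
      tripleTerm a b N M n + X ^ (a + (a + b) * N) * tripleTerm a b N M (n - 1) := by
  by_cases h : n < -M ∨ (N : ℤ) + 1 < n
  · rw [tripleTerm_eq_zero (n := n) (N := N + 1) (by push_cast; omega),
      tripleTerm_eq_zero (n := n) (by omega), tripleTerm_eq_zero (n := n - 1) (by omega)]
    simp
  · obtain ⟨p, hp⟩ : ∃ p : ℕ, (p : ℤ) = N + 1 - n := ⟨(N + 1 - n).toNat, by omega⟩
    obtain ⟨q, hq⟩ : ∃ q : ℕ, (q : ℤ) = M + n := ⟨(M + n).toNat, by omega⟩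
    have hw : a + (a + b) * N + blockSum a b (n - 1) = blockSum a b n + (a + b) * p := by
      have h1 := blockSum_succ a b (n - 1)
      rw [sub_add_cancel] at h1
      have : (N : ℤ) = p + n - 1 := by omega
      zify
      rw [this, h1]
      ring
    have hw' : (X : ℚ⟦X⟧) ^ (a + (a + b) * N) * X ^ blockSum a b (n - 1) =
        X ^ blockSum a b n * (X ^ (a + b)) ^ p := by
      rw [← pow_add, hw, pow_add, pow_mul]
    have hN : N + M + 1 = p + q := by omega
    have e1 : ((N + 1 : ℕ) : ℤ) - n = p := by push_cast; omega
    have e2 : (N : ℤ) - n = (p : ℤ) - 1 := by omega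
    have e3 : (N : ℤ) - (n - 1) = p := by omega
    have e4 : (M : ℤ) + (n - 1) = (q : ℤ) - 1 := by omega
    rw [tripleTerm, tripleTerm, tripleTerm, e1, e2, e3, e4, ← hq, extTail_sub_one hm,
      extTail_sub_one hm, hN, pow_add]
    linear_combination (-(1 - ((X : ℚ⟦X⟧) ^ (a + b)) ^ q) * extTail (a + b) p *
      extTail (a + b) q) * hw'

/-- The finite sum in the finite form of the Jacobi triple product. -/
noncomputable def tripleSum (a b N M : ℕ) : ℚ⟦X⟧ := ∑ᶠ n, tripleTerm a b N M n

theorem tripleSum_swap (a b N M : ℕ) : tripleSum a b N M = tripleSum b a M N := by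
  rw [tripleSum, tripleSum, ← finsum_comp_equiv (Equiv.neg ℤ)]
  exact finsum_congr fun n => by rw [tripleTerm_swap]; simp

theorem tripleSum_succ {a b : ℕ} (hm : 0 < a + b) (N M : ℕ) :
    tripleSum a b (N + 1) M * (1 - (X ^ (a + b)) ^ (N + M + 1)) =
      tripleSum a b N M * (1 + X ^ (a + (a + b) * N)) := by
  have hshift : ∑ᶠ n, tripleTerm a b N M (n - 1) = tripleSum a b N M :=
    finsum_comp_equiv (Equiv.subRight (1 : ℤ)) (f := tripleTerm a b N M)
  have hfin : (Function.support fun n => tripleTerm a b N M (n - 1)).Finite :=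
    (finite_support_tripleTerm a b N M).preimage (f := fun n : ℤ => n - 1)
      (sub_left_injective.injOn)
  rw [tripleSum, finsum_mul]
  simp_rw [tripleTerm_succ hm]
  rw [finsum_add_distrib (finite_support_tripleTerm a b N M), ← mul_finsum, hshift,
    ← tripleSum]
  · ring
  · exact hfin.subset fun n hn h => hn (by simp [h])

theorem tripleSum_zero_zero (a b : ℕ) : tripleSum a b 0 0 = tailProd (a + b) 0 ^ 2 := by
  rw [tripleSum, finsum_eq_single _ 0]
  · simp [tripleTerm, blockSum, extTail, sq]
  · intro n hn
    exact tripleTerm_eq_zero (by simp only [Nat.cast_zero]; omega)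

/-- Only the recurrence in `N` is needed: `tripleSum_swap` exchanges `(a, N)` with `(b, M)`, which
is why the induction generalizes `a` and `b`. -/
theorem tripleSum_mul {a b : ℕ} (hm : 0 < a + b) (N M : ℕ) :
    tripleSum a b N M * ∏ i ∈ Finset.range (N + M), (1 - ((X : ℚ⟦X⟧) ^ (a + b)) ^ (i + 1)) =
      tailProd (a + b) 0 ^ 2 * (∏ j ∈ Finset.range N, (1 + X ^ (a + (a + b) * j))) *
        ∏ j ∈ Finset.range M, (1 + X ^ (b + (a + b) * j)) := by
  induction M generalizing a b N with
  | zero =>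
    induction N with
    | zero => simp [tripleSum_zero_zero]
    | succ N ih =>
      rw [show N + 1 + 0 = N + 0 + 1 from rfl, Finset.prod_range_succ _ (N + 0), mul_left_comm,
        mul_comm, tripleSum_succ hm, Finset.prod_range_succ _ N, mul_right_comm, ih]
      ring
  | succ M ih =>
    rw [← add_assoc, tripleSum_swap, Finset.prod_range_succ _ (N + M), mul_left_comm,
      mul_comm, add_comm N M, add_comm a b, tripleSum_succ (by omega), mul_right_comm,
      tripleSum_swap, add_comm b a, add_comm M N, ih hm, Finset.prod_range_succ _ M]
    ring

/-! ### Passage to the infinite triple product -/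

theorem summable_X_pow {ι : Type*} {w : ι → ℕ} (hw : ∀ d, {i | w i = d}.Finite) :
    Summable fun i => (X : ℚ⟦X⟧) ^ w i := by
  rw [PowerSeries.WithPiTopology.summable_iff_summable_coeff]
  intro d
  refine summable_of_hasFiniteSupport ((hw d).subset fun i hi => ?_)
  by_contra h
  exact hi (by simp only [coeff_X_pow]; rw [if_neg (Ne.symm h)])

theorem summable_X_pow_blockSum {a b : ℕ} (ha : 0 < a) (hb : 0 < b) :
    Summable fun n : ℤ => (X : ℚ⟦X⟧) ^ blockSum a b n :=
  summable_X_pow fun d => (Set.finite_Icc (-(d : ℤ)) d).subset fun n (hn : _ = d) => by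
    have := natAbs_le_blockSum ha hb n
    rw [Set.mem_Icc]
    omega

/-- Terms with `|n| > d` start beyond degree `d`. For `|n| ≤ d`, the bound `2 * d ≤ N` makes both
tail indices at least `d`, so both tails are `1` modulo `X ^ (d + 1)`. -/
theorem coeff_tripleSum {a b : ℕ} (ha : 0 < a) (hb : 0 < b) {d N : ℕ} (hN : 2 * d ≤ N) :
    coeff d (tripleSum a b N N) = coeff d (∑' n : ℤ, (X : ℚ⟦X⟧) ^ blockSum a b n) := by
  have hsum := (PowerSeries.WithPiTopology.hasSum_iff_hasSum_coeff ℚ).1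
    (summable_X_pow_blockSum ha hb).hasSum d
  have hbig : ∀ n : ℤ, d < n.natAbs → ∀ F : ℚ⟦X⟧, coeff d (X ^ blockSum a b n * F) = 0 := by
    intro n hn F
    have := natAbs_le_blockSum ha hb n
    exact X_pow_dvd_iff.1 (Dvd.intro _ rfl) d (by omega)
  have hsum' : HasSum (fun n : ℤ => coeff d ((X : ℚ⟦X⟧) ^ blockSum a b n))
      (∑ n ∈ Finset.Icc (-(N : ℤ)) N, coeff d ((X : ℚ⟦X⟧) ^ blockSum a b n)) :=
    hasSum_sum_of_ne_finset_zero fun n hn => by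
      rw [Finset.mem_Icc] at hn
      simpa using hbig n (by omega) 1
  rw [hsum.unique hsum', tripleSum,
    finsum_eq_sum_of_support_subset _ (support_tripleTerm_subset a b N N), map_sum]
  refine Finset.sum_congr rfl fun n _ => ?_
  rw [tripleTerm, mul_assoc]
  rcases lt_or_ge d n.natAbs with h | h
  · rw [hbig n h]
    simpa using (hbig n h 1).symm
  · obtain ⟨p, hp⟩ : ∃ p : ℕ, (p : ℤ) = N - n := ⟨(N - n).toNat, by omega⟩
    obtain ⟨q, hq⟩ : ∃ q : ℕ, (q : ℤ) = N + n := ⟨(N + n).toNat, by omega⟩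
    rw [← hp, ← hq, extTail_natCast, extTail_natCast, ← sub_eq_zero, ← map_sub]
    refine (X_pow_dvd_iff (n := d + 1)).1 ?_ d (Nat.lt_succ_self d)
    have h1 := (pow_dvd_pow (X : ℚ⟦X⟧) (show d + 1 ≤ p + 1 by omega)).trans
      (X_pow_dvd_tailProd_sub_one (m := a + b) (by omega) p)
    have h2 := (pow_dvd_pow (X : ℚ⟦X⟧) (show d + 1 ≤ q + 1 by omega)).trans
      (X_pow_dvd_tailProd_sub_one (m := a + b) (by omega) q)
    have h3 : (X : ℚ⟦X⟧) ^ blockSum a b n * (tailProd (a + b) p * tailProd (a + b) q) -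
        X ^ blockSum a b n = X ^ blockSum a b n * tailProd (a + b) q * (tailProd (a + b) p - 1) +
          X ^ blockSum a b n * (tailProd (a + b) q - 1) := by ring
    rw [h3]
    exact dvd_add (h1.mul_left _) (h2.mul_left _)

/-- `∏_{j ≥ 0} (1 + X ^ (a + m j))`. -/
noncomputable def apProd (m a : ℕ) : ℚ⟦X⟧ := ∏' j : ℕ, (1 + X ^ (a + m * j))

theorem multipliable_apProd {m a : ℕ} (hm : 0 < m) (ha : 0 < a) :
    Multipliable fun j : ℕ => (1 + (X : ℚ⟦X⟧) ^ (a + m * j)) :=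
  multipliable_one_add_of_X_pow_dvd fun j => pow_dvd_pow _ (by nlinarith)

/-- The Jacobi triple product identity. -/
theorem tsum_X_pow_blockSum {a b : ℕ} (ha : 0 < a) (hb : 0 < b) :
    ∑' n : ℤ, (X : ℚ⟦X⟧) ^ blockSum a b n =
      qProd (X ^ (a + b)) * apProd (a + b) a * apProd (a + b) b := by
  have hm : 0 < a + b := by omega
  have h1 : Filter.Tendsto (fun N => tripleSum a b N N) Filter.atTop
      (nhds (∑' n : ℤ, (X : ℚ⟦X⟧) ^ blockSum a b n)) := by
    rw [PowerSeries.WithPiTopology.tendsto_iff_coeff_tendsto]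
    intro d
    refine tendsto_const_nhds.congr' ?_
    filter_upwards [Filter.eventually_ge_atTop (2 * d)] with N hN
    exact (coeff_tripleSum ha hb hN).symm
  have h2 : Filter.Tendsto (fun N => ∏ i ∈ Finset.range (N + N),
      (1 - ((X : ℚ⟦X⟧) ^ (a + b)) ^ (i + 1))) Filter.atTop (nhds (qProd (X ^ (a + b)))) :=
    (multipliable_qProd (a + b) hm).hasProd.tendsto_prod_nat.comp
      (Filter.tendsto_atTop_mono (fun N => Nat.le_add_left N N) Filter.tendsto_id)
  have h3 := (multipliable_apProd hm ha).hasProd.tendsto_prod_nat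
  have h4 := (multipliable_apProd hm hb).hasProd.tendsto_prod_nat
  have h5 := h1.mul h2
  simp_rw [tripleSum_mul hm] at h5
  have h6 := tendsto_nhds_unique h5 ((h3.const_mul (tailProd (a + b) 0 ^ 2)).mul h4)
  rw [tailProd_zero] at h6
  -- The limit identity carries one `qProd` on the left and two on the right; one cancels.
  refine mul_right_cancel₀ (qProd_X_pow_ne_zero hm) (h6.trans ?_)
  rw [apProd, apProd]
  ring

/-! ### Sums over integer vectors -/

theorem finite_sum_eq {t : ℕ} {g : Fin t → ℤ → ℕ} (hg : ∀ i n, n.natAbs ≤ g i n) (d : ℕ) :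
    {f : Fin t → ℤ | ∑ i, g i (f i) = d}.Finite := by
  refine (Set.Finite.pi' fun _ => Set.finite_Icc (-(d : ℤ)) d).subset fun f hf i => ?_
  have h1 := hg i (f i)
  have h2 : g i (f i) ≤ ∑ i, g i (f i) :=
    Finset.single_le_sum (f := fun i => g i (f i)) (fun _ _ => Nat.zero_le _) (Finset.mem_univ i)
  have h3 : ∑ i, g i (f i) = d := hf
  rw [Set.mem_Icc]
  omega

theorem hasSum_X_pow_sum {t : ℕ} {g : Fin t → ℤ → ℕ} (hg : ∀ i n, n.natAbs ≤ g i n) :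
    HasSum (fun f : Fin t → ℤ => (X : ℚ⟦X⟧) ^ ∑ i, g i (f i)) (∏ i, ∑' n, X ^ g i n) := by
  induction t with
  | zero => simp
  | succ t ih =>
    have hs := summable_X_pow (finite_sum_eq hg)
    let e : ℤ × (Fin t → ℤ) ≃ (Fin (t + 1) → ℤ) := Fin.consEquiv fun _ => ℤ
    have he : (fun f : Fin (t + 1) → ℤ => (X : ℚ⟦X⟧) ^ ∑ i, g i (f i)) ∘ e =
        fun p : ℤ × (Fin t → ℤ) => X ^ g 0 p.1 * X ^ ∑ i : Fin t, g i.succ (p.2 i) := by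
      funext p
      simp [e, Fin.consEquiv, Fin.sum_univ_succ, pow_add]
    rw [← e.summable_iff, he] at hs
    rw [← e.hasSum_iff, Fin.prod_univ_succ, he]
    have h0 : Summable fun n : ℤ => (X : ℚ⟦X⟧) ^ g 0 n :=
      summable_X_pow fun d => (Set.finite_Icc (-(d : ℤ)) d).subset fun n (hn : _ = d) => by
        have := hg 0 n
        rw [Set.mem_Icc]
        omega
    have hi := ih (g := fun i => g i.succ) fun i n => hg i.succ n
    have h2 := HasSum.mul (f := fun n : ℤ => (X : ℚ⟦X⟧) ^ g 0 n)
      (g := fun f : Fin t → ℤ => (X : ℚ⟦X⟧) ^ ∑ i : Fin t, g i.succ (f i)) h0.hasSum hi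
    -- Summability of the product family comes from the finiteness of the set of vectors of each
    -- given weight.
    have h3 := h2 hs
    exact h3

/-! ### Sorting infinite products by residue class -/

theorem prod_range_mul_eq {M : Type*} [CommMonoid M] (f : ℕ → M) (m N : ℕ) :
    ∏ n ∈ Finset.range (m * N), f n =
      ∏ r ∈ Finset.range m, ∏ j ∈ Finset.range N, f (r + m * j) := by
  induction N with
  | zero => simp
  | succ N ih =>
    rw [mul_add_one, Finset.prod_range_add, ih, ← Finset.prod_mul_distrib]
    exact Finset.prod_congr rfl fun r _ => by rw [Finset.prod_range_succ, add_comm r]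

theorem apProd_eq_prod {c a m : ℕ} (hc : 0 < c) (ha : 0 < a) (hm : 0 < m) :
    apProd c a = ∏ r ∈ Finset.range m, apProd (c * m) (a + c * r) := by
  have h1 := (multipliable_apProd hc ha).hasProd.tendsto_prod_nat.comp
    (Filter.tendsto_id.const_mul_atTop' hm)
  have h2 : Filter.Tendsto (fun N => ∏ r ∈ Finset.range m, ∏ j ∈ Finset.range N,
      (1 + (X : ℚ⟦X⟧) ^ (a + c * r + c * m * j))) Filter.atTop
      (nhds (∏ r ∈ Finset.range m, apProd (c * m) (a + c * r))) :=
    tendsto_finsetProd _ fun r _ =>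
      (multipliable_apProd (Nat.mul_pos hc hm) (by omega)).hasProd.tendsto_prod_nat
  refine tendsto_nhds_unique h1 (h2.congr fun N => ?_)
  rw [Function.comp_apply, id, prod_range_mul_eq]
  exact Finset.prod_congr rfl fun r _ => Finset.prod_congr rfl fun j _ => by ring

theorem apProd_self_mul_qProd {c : ℕ} (hc : 0 < c) :
    apProd c c * qProd (X ^ c) = qProd (X ^ (2 * c)) := by
  rw [apProd, qProd, ← (multipliable_apProd hc hc).tprod_mul (multipliable_qProd c hc), qProd]
  exact tprod_congr fun j => by ring

/-- All residues modulo `2 (t + 1)` occur once: the pairs `±(i + 1)` omit exactly `t + 1` and `0`,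
and these two make up the progression of multiples of `t + 1`. -/
theorem prod_apProd_mul (t : ℕ) :
    (∏ i : Fin t, (apProd (2 * (t + 1)) (i + 1) * apProd (2 * (t + 1)) (2 * (t + 1) - (i + 1)))) *
      apProd (t + 1) (t + 1) = apProd 1 1 := by
  rw [apProd_eq_prod (c := 1) (m := 2 * (t + 1)) one_pos one_pos (by omega),
    apProd_eq_prod (c := t + 1) (m := 2) (by omega) (by omega) two_pos,
    Fin.prod_univ_eq_prod_range (fun i => apProd (2 * (t + 1)) (i + 1) *
      apProd (2 * (t + 1)) (2 * (t + 1) - (i + 1))), Finset.prod_mul_distrib,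
    show Finset.range (2 * (t + 1)) = Finset.range (t + 1 + t + 1) by congr 1; omega,
    Finset.prod_range_succ _ (t + 1 + t), Finset.prod_range_add _ (t + 1) t,
    Finset.prod_range_succ _ t, Finset.prod_range_succ _ 1, Finset.prod_range_one, ← Finset.prod_range_reflect (fun i => apProd _ (1 + 1 * (t + 1 + i)))]
  have h1 : ∏ i ∈ Finset.range t, apProd (1 * (2 * (t + 1))) (1 + 1 * (t + 1 + (t - 1 - i))) =
      ∏ i ∈ Finset.range t, apProd (2 * (t + 1)) (2 * (t + 1) - (i + 1)) := by
    refine Finset.prod_congr rfl fun i hi => ?_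
    rw [Finset.mem_range] at hi
    congr 1 <;> omega
  have h2 : (t + 1) * 2 = 2 * (t + 1) := mul_comm _ _
  have h3 : ∀ i, 1 + 1 * i = i + 1 := fun i => by ring
  have h4 : t + 1 + (t + 1) * 1 = t + 1 + t + 1 := by ring
  rw [h1, h2, h4, mul_zero, add_zero, one_mul]
  simp only [h3]
  ring

/-! ### Assembling the generating function -/

theorem hasSum_weightMonomial (t : ℕ) : HasSum (weightMonomial (t + 1))
    (∏ i : Fin t, ∑' n : ℤ, X ^ blockSum (i + 1) (2 * (t + 1) - (i + 1)) n) := by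
  have h1 := hasSum_X_pow_sum (t := t)
    (g := fun i : Fin t => blockSum (i + 1) (2 * (t + 1) - (i + 1)))
    fun i n => natAbs_le_blockSum (by omega) (by omega) n
  have h2 : (fun f : Fin t → ℤ =>
      (X : ℚ⟦X⟧) ^ ∑ i : Fin t, blockSum (i + 1) (2 * (t + 1) - (i + 1)) (f i)) =
      (fun C : {C : Finset ℕ // IsCoreSet (t + 1) C} => X ^ ∑ c ∈ C.1, c) ∘ blockUnionEquiv t := by
    funext f
    rw [Function.comp_apply, sum_blockUnionEquiv]
  have h3 : weightMonomial (t + 1) = (fun C : {C : Finset ℕ // IsCoreSet (t + 1) C} =>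
      (X : ℚ⟦X⟧) ^ ∑ c ∈ C.1, c) ∘ coreSetEquiv (Nat.succ_pos t) := by
    funext p
    rw [Function.comp_apply, sum_coreSetEquiv, weightMonomial]
  rw [h2, Equiv.hasSum_iff] at h1
  rw [h3, Equiv.hasSum_iff]
  exact h1

/-- Denominators are cleared, including the exponent `-1` at `t = 0`, so that the identity lives in
power series. -/
theorem h_mul_qProd (t : ℕ) : h (t + 1) * qProd (X ^ (2 * (t + 1))) * qProd X =
    qProd (X ^ (2 * (t + 1))) ^ t * qProd (X ^ 2) * qProd (X ^ (t + 1)) := by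
  have h1 : ∀ i : Fin t, ∑' n : ℤ, (X : ℚ⟦X⟧) ^ blockSum (i + 1) (2 * (t + 1) - (i + 1)) n =
      qProd (X ^ (2 * (t + 1))) *
        (apProd (2 * (t + 1)) (i + 1) * apProd (2 * (t + 1)) (2 * (t + 1) - (i + 1))) := by
    intro i
    have h2 : (i : ℕ) + 1 + (2 * (t + 1) - (i + 1)) = 2 * (t + 1) := by omega
    rw [tsum_X_pow_blockSum (by omega) (by omega), h2, mul_assoc]
  have h3 := apProd_self_mul_qProd (Nat.succ_pos t)
  have h4 := apProd_self_mul_qProd one_pos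
  rw [pow_one, mul_one] at h4
  rw [h, (hasSum_weightMonomial t).tsum_eq, Finset.prod_congr rfl fun i _ => h1 i,
    Finset.prod_mul_distrib, Finset.prod_const, Finset.card_univ, Fintype.card_fin,
    ← h4, ← prod_apProd_mul t]
  -- The extra factor on the left, not the `t`-th power, supplies the missing multiples of `t + 1`.
  nth_rewrite 2 [← h3]
  ring

end CoreGF

theorem mainTheorem7 (t : ℕ) :
    Summable (CoreGF.weightMonomial (t + 1)) ∧
    ((CoreGF.h (t + 1) : ℚ⟦X⟧) : ℚ⸨X⸩) =
      (CoreGF.qProd (X ^ 2) : ℚ⸨X⸩) / (CoreGF.qProd X : ℚ⸨X⸩)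
        * (CoreGF.qProd (X ^ (t + 1)) : ℚ⸨X⸩)
        * (CoreGF.qProd (X ^ (2 * t + 2)) : ℚ⸨X⸩) ^ ((t : ℤ) - 1) := by
  refine ⟨(CoreGF.hasSum_weightMonomial t).summable, ?_⟩
  -- Nonvanishing in the Laurent series field justifies the division and splits the power `t - 1`,
  -- also for `t = 0`.
  have hne : ∀ m : ℕ, 0 < m → (CoreGF.qProd (X ^ m) : ℚ⸨X⸩) ≠ 0 := fun m hm h0 =>
    CoreGF.qProd_X_pow_ne_zero hm (HahnSeries.ofPowerSeries_injective
      (h0.trans (map_zero (HahnSeries.ofPowerSeries ℤ ℚ)).symm))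
  have h1 := hne 1 one_pos
  rw [pow_one] at h1
  have h2 := hne (2 * t + 2) (by omega)
  have key := congrArg (HahnSeries.ofPowerSeries ℤ ℚ) (CoreGF.h_mul_qProd t)
  rw [show 2 * (t + 1) = 2 * t + 2 by ring] at key
  simp only [map_mul, map_pow] at key
  rw [zpow_sub_one₀ h2, zpow_natCast]
  field_simp
  linear_combination key
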